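/- Let $p$ be a prime and let $K$ be a perfectoid field of residue characteristic $p$: a field that is complete for a non-discrete rank one non-archimedean absolute value, with $|p|<1$ and surjective Frobenius on $\mathcal O_K/p$. Let $q\in K^\times$ with $|q|<1$, and fix a compatible system of $p$-power roots $q^{1/p^i}\in K$, so that $q^{e}\in K^\times$ is defined for $e\in\mathbb Z[1/p]$. Let $\overline K$ be an algebraic closure of $K$. A holomorphic function is a Laurent series $g=\sum_e a_eX^e$, $a_e\in K$, with exponents in $p^{-i}\mathbb Z$ for some $i\ge 0$ depending on $g$, such that $|a_e|r^e\to 0$ (along the filter of cofinite sets of exponents) for every real $r>0$. These functions form an integral domain $H$; a meromorphic function is an element of its fraction field. A meromorphic function $f$ is $q$-periodic if $f(q^{-1}X)=f(X)$, where $X^e\mapsto q^{-e}X^e$ under $X\mapsto q^{-1}X$. For $\alpha\in\overline K^\times$ let $\varphi_\alpha$ be its minimal polynomial over $K$. For $m=k/p^i$ with integers $k,i\ge 0$, an $m$-th power of $\varphi_\alpha$ is an $s\in H$ with $s^{p^i}=\varphi_\alpha^k$. For $0\ne g\in H$, $\mathrm{ord}_\alpha(g)$ is the largest $m\in\mathbb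 Z[1/p]_{\ge 0}$ such that some $m$-th power of $\varphi_\alpha$ divides $g$ in $H$. For a meromorphic function $f$, the equation $\mathrm{ord}_\alpha(f)=m$ means that $\mathrm{ord}_\alpha(g)-\mathrm{ord}_\alpha(h)=m$ (both orders existing) for every way to write $f=g/h$ with $g,h\in H$, $h\neq 0$. Finally, $\beta\in\overline K^\times$ is $K$-conjugate to $\alpha$ modulo $q^{p^{-\infty}}$ if $\beta=q^{e}\gamma$ for some $e\in\mathbb Z[1/p]$ and some root $\gamma$ of $\varphi_\alpha$. **Corollary.** For every $\alpha\in\overline K^\times$ there is a $q$-periodic meromorphic function $f$ with $\mathrm{ord}_\alpha(f)=1$. Moreover, for every $\beta\in\overline K^\times$ that is not $K$-conjugate to $\alpha$ modulo $q^{p^{-\infty}}$, there is a $q$-periodic meromorphic function $f$ with $\mathrm{ord}_\alpha(f)=1$ and $\mathrm{ord}_\beta(f)=0$. -/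

import Mathlib

open Filter Topology Polynomial

set_option linter.unusedSectionVars false

/-- A perfectoid field of residue characteristic `p`: a field that is complete for a rank one
non-archimedean absolute value (see the type classes) whose value group is not discrete, with
`|p| < 1`, and such that the Frobenius map is surjective on `𝒪 / p`. -/
structure IsPerfectoidField (p : ℕ) (K : Type*) [NontriviallyNormedField K]
    [IsUltrametricDist K] [CompleteSpace K] : Prop where
  norm_p_lt_one : ‖(p : K)‖ < 1
  not_discrete : ∀ ε : ℝ, 1 < ε → ∃ x : K, 1 < ‖x‖ ∧ ‖x‖ < ε
  frobenius_surjective : ∀ x : K, ‖x‖ ≤ 1 → ∃ y z : K, ‖y‖ ≤ 1 ∧ ‖z‖ ≤ 1 ∧ x = y ^ p + p * z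

/-- A Laurent series `∑ aₑ X ^ e` over `K` with exponents in `p⁻ⁱ ℤ` for some `i` (depending on
the series), converging for every value `0 < |X| = r < ∞`: a holomorphic function in
`X ^ (1 / p ^ ∞)` on the punctured line. -/
@[ext]
structure PerfLaurent (p : ℕ) (K : Type*) [NontriviallyNormedField K] where
  coeff : ℚ → K
  bounded_denom : ∃ i : ℕ, ∀ e : ℚ, coeff e ≠ 0 → ∃ k : ℤ, e = k / (p : ℚ) ^ i
  converges : ∀ r : ℝ, 0 < r → Tendsto (fun e : ℚ => ‖coeff e‖ * r ^ (e : ℝ)) cofinite (𝓝 0)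

/-- A non-zero element `q = seq 0` of `K` with a compatible system `seq i = q ^ (1 / p ^ i)` of
`p`-power roots. -/
structure RootSystem (p : ℕ) (K : Type*) [NontriviallyNormedField K] where
  seq : ℕ → K
  ne_zero : seq 0 ≠ 0
  compat : ∀ i, seq (i + 1) ^ p = seq i

section Aux

variable {K : Type*} [NontriviallyNormedField K] [IsUltrametricDist K]

theorem norm_tsum_le_of_forall_ultra {ι : Type*} {f : ι → K} {C : ℝ} (hC : 0 ≤ C)
    (h : ∀ i, ‖f i‖ ≤ C) : ‖∑' i, f i‖ ≤ C := by
  by_cases hf : Summable f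
  · have hcl : IsClosed {x : K | ‖x‖ ≤ C} := isClosed_le continuous_norm continuous_const
    refine hcl.mem_of_tendsto hf.hasSum (Eventually.of_forall fun s => ?_)
    exact IsUltrametricDist.norm_sum_le_of_forall_le_of_nonneg hC fun i _ => h i
  · simpa [tsum_eq_zero_of_not_summable hf] using hC

theorem norm_tsum_lt_of_forall_ultra {ι : Type*} {f : ι → K} {C : ℝ} (hC : 0 < C)
    (h : ∀ i, ‖f i‖ < C) : ‖∑' i, f i‖ < C := by
  by_cases hf : Summable f
  · have hcl : IsClosed {x : K | ‖x‖ < C} := by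
      have := IsUltrametricDist.isClosed_ball (0 : K) C
      simpa [Metric.ball, dist_zero_right] using this
    refine hcl.mem_of_tendsto hf.hasSum (Eventually.of_forall fun s => ?_)
    induction s using Finset.cons_induction with
    | empty => simpa using hC
    | cons i s hi ih =>
      rw [Finset.sum_cons]
      exact (IsUltrametricDist.norm_add_le_max _ _).trans_lt (max_lt (h i) ih)
  · simpa [tsum_eq_zero_of_not_summable hf] using hC

end Aux

namespace PerfLaurent

variable {p : ℕ} {K : Type*} [NontriviallyNormedField K]

theorem tendsto_coeff (a : PerfLaurent p K) : Tendsto a.coeff cofinite (𝓝 0) := by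
  rw [tendsto_zero_iff_norm_tendsto_zero]
  simpa using a.converges 1 one_pos

theorem tendsto_pair (a b : PerfLaurent p K) :
    Tendsto (fun x : ℚ × ℚ => a.coeff x.1 * b.coeff x.2) cofinite (𝓝 0) :=
  tendsto_mul_cofinite_nhds_zero a.tendsto_coeff b.tendsto_coeff

theorem tendsto_triple (a b c : PerfLaurent p K) :
    Tendsto (fun x : ℚ × ℚ × ℚ => a.coeff x.1 * (b.coeff x.2.1 * c.coeff x.2.2)) cofinite
      (𝓝 0) :=
  tendsto_mul_cofinite_nhds_zero (f := a.coeff)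
    (g := fun x : ℚ × ℚ => b.coeff x.1 * c.coeff x.2) a.tendsto_coeff (tendsto_pair b c)

theorem converges_of_finite {a : ℚ → K} (h : {e | a e ≠ 0}.Finite) (r : ℝ) :
    Tendsto (fun e : ℚ => ‖a e‖ * r ^ (e : ℝ)) cofinite (𝓝 0) := by
  refine tendsto_nhds_of_eventually_eq ?_
  filter_upwards [h.compl_mem_cofinite] with e he
  have : a e = 0 := by simpa using he
  simp [this]

theorem common_denom (a b : PerfLaurent p K) (hp : p ≠ 0) : ∃ i : ℕ,
    (∀ e : ℚ, a.coeff e ≠ 0 → ∃ k : ℤ, e = k / (p : ℚ) ^ i) ∧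
    (∀ e : ℚ, b.coeff e ≠ 0 → ∃ k : ℤ, e = k / (p : ℚ) ^ i) := by
  obtain ⟨i, hi⟩ := a.bounded_denom
  obtain ⟨j, hj⟩ := b.bounded_denom
  have hp' : (p : ℚ) ≠ 0 := by exact_mod_cast hp
  refine ⟨i + j, fun e he => ?_, fun e he => ?_⟩
  · obtain ⟨k, rfl⟩ := hi e he
    refine ⟨k * p ^ j, ?_⟩
    push_cast
    field_simp
    ring
  · obtain ⟨k, rfl⟩ := hj e he
    refine ⟨k * p ^ i, ?_⟩
    push_cast
    field_simp
    ring

instance : Zero (PerfLaurent p K) :=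
  ⟨⟨0, ⟨0, fun e he => absurd rfl he⟩, fun r _ => converges_of_finite (by simp) r⟩⟩

/-- The element of the ring given by an ordinary polynomial in `X`. -/
def ofPolynomial (P : K[X]) : PerfLaurent p K where
  coeff e := if e.den = 1 ∧ 0 ≤ e then P.coeff e.num.toNat else 0
  bounded_denom := by
    refine ⟨0, fun e he => ⟨e.num, ?_⟩⟩
    have h : e.den = 1 ∧ 0 ≤ e := by
      by_contra h
      exact he (if_neg h)
    simpa using (Rat.den_eq_one_iff e).mp h.1 |>.symm
  converges r _ := by
    refine converges_of_finite (Set.Finite.subset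
      (P.support.finite_toSet.image (fun n : ℕ => (n : ℚ))) fun e he => ?_) r
    simp only [ne_eq, ite_eq_right_iff, Set.mem_ofPred_eq, Classical.not_imp] at he
    obtain ⟨⟨h1, h2⟩, h3⟩ := he
    refine ⟨e.num.toNat, by simpa using h3, ?_⟩
    have h4 : ((e.num.toNat : ℤ) : ℚ) = (e.num : ℚ) := by
      rw [Int.toNat_of_nonneg (Rat.num_nonneg.mpr h2)]
    have h5 := (Rat.den_eq_one_iff e).mp h1
    rw [h5] at h4
    exact_mod_cast h4

instance : One (PerfLaurent p K) :=
  ⟨⟨fun e => if e = 0 then 1 else 0, ⟨0, fun e he => ⟨0, by simpa using he⟩⟩,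
    fun r _ => converges_of_finite ((Set.finite_singleton (0 : ℚ)).subset
      fun e he => by simpa using he) r⟩⟩

instance : Neg (PerfLaurent p K) :=
  ⟨fun a => ⟨fun e => -a.coeff e, by simpa using a.bounded_denom,
    fun r hr => by simpa using a.converges r hr⟩⟩

variable [Fact p.Prime]

instance : Add (PerfLaurent p K) :=
  ⟨fun a b => ⟨fun e => a.coeff e + b.coeff e, by
      obtain ⟨i, hi, hj⟩ := common_denom a b (Fact.out : p.Prime).ne_zero
      refine ⟨i, fun e he => ?_⟩
      by_cases ha : a.coeff e = 0
      · exact hj e fun hb => he (by simp [ha, hb])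
      · exact hi e ha,
    fun r hr => by
      have h := (a.converges r hr).add (b.converges r hr)
      rw [add_zero] at h
      refine squeeze_zero (fun e => by positivity) (fun e => ?_) h
      rw [← add_mul]
      exact mul_le_mul_of_nonneg_right (norm_add_le _ _) (by positivity)⟩⟩

variable [IsUltrametricDist K]

/-- The Cauchy product; the sums over `k` converge when `K` is complete. -/
noncomputable instance : Mul (PerfLaurent p K) :=
  ⟨fun a b => ⟨fun e => ∑' k : ℚ, a.coeff k * b.coeff (e - k), by
      obtain ⟨i, hi, hj⟩ := common_denom a b (Fact.out : p.Prime).ne_zero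
      refine ⟨i, fun e he => ?_⟩
      have : ∃ k, a.coeff k * b.coeff (e - k) ≠ 0 := by
        by_contra! h
        exact he (by simp [h])
      obtain ⟨k, hk⟩ := this
      obtain ⟨m, hm⟩ := hi k (left_ne_zero_of_mul hk)
      obtain ⟨n, hn⟩ := hj _ (right_ne_zero_of_mul hk)
      refine ⟨m + n, ?_⟩
      push_cast
      rw [add_div, ← hm, ← hn]
      ring,
    fun r hr => by
      have h := tendsto_mul_cofinite_nhds_zero (a.converges r hr) (b.converges r hr)
      rw [Metric.tendsto_nhds] at h ⊢
      intro ε hε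
      have h1 := h (ε / 2) (half_pos hε)
      rw [eventually_cofinite] at h1 ⊢
      refine (h1.image (fun x : ℚ × ℚ => x.1 + x.2)).subset fun e he => ?_
      by_contra hne
      apply he
      have hre : 0 < r ^ (e : ℝ) := Real.rpow_pos_of_pos hr _
      have key : ‖∑' k : ℚ, a.coeff k * b.coeff (e - k)‖ ≤ ε / 2 / r ^ (e : ℝ) := by
        refine norm_tsum_le_of_forall_ultra (by positivity) fun k => ?_
        have h2 : ¬ ¬ dist (‖a.coeff k‖ * r ^ (k : ℝ) *
            (‖b.coeff (e - k)‖ * r ^ ((e - k : ℚ) : ℝ))) 0 < ε / 2 := fun hcon =>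
          hne ⟨(k, e - k), hcon, by ring⟩
        rw [not_not, Real.dist_0_eq_abs, abs_of_nonneg (by positivity)] at h2
        rw [le_div_iff₀ hre, norm_mul]
        have h3 : r ^ (e : ℝ) = r ^ (k : ℝ) * r ^ ((e - k : ℚ) : ℝ) := by
          rw [← Real.rpow_add hr]
          push_cast
          ring_nf
        rw [h3]
        nlinarith
      rw [Real.dist_0_eq_abs, abs_of_nonneg (by positivity)]
      rw [le_div_iff₀ hre] at key
      linarith⟩⟩

@[simp] theorem coeff_zero (e : ℚ) : (0 : PerfLaurent p K).coeff e = 0 := rfl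

theorem coeff_one (e : ℚ) : (1 : PerfLaurent p K).coeff e = if e = 0 then 1 else 0 := rfl

@[simp] theorem coeff_add (a b : PerfLaurent p K) (e : ℚ) :
    (a + b).coeff e = a.coeff e + b.coeff e := rfl

@[simp] theorem coeff_neg (a : PerfLaurent p K) (e : ℚ) : (-a).coeff e = -a.coeff e := rfl

theorem coeff_mul (a b : PerfLaurent p K) (e : ℚ) :
    (a * b).coeff e = ∑' k : ℚ, a.coeff k * b.coeff (e - k) := rfl

protected theorem mul_comm' (a b : PerfLaurent p K) : a * b = b * a := by
  ext e
  rw [coeff_mul, coeff_mul, ← (Equiv.subLeft e).tsum_eq]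
  exact tsum_congr fun k => by simp [mul_comm]

protected theorem one_mul' (a : PerfLaurent p K) : 1 * a = a := by
  ext e
  rw [coeff_mul, tsum_eq_single 0 fun k hk => by simp [coeff_one, hk]]
  simp [coeff_one]

variable [CompleteSpace K]

theorem summable_mul (a b : PerfLaurent p K) (e : ℚ) :
    Summable fun k : ℚ => a.coeff k * b.coeff (e - k) := by
  apply NonarchimedeanAddGroup.summable_of_tendsto_cofinite_zero
  have hinj : Function.Injective fun k : ℚ => (k, e - k) := fun x y h => (Prod.ext_iff.mp h).1
  exact (tendsto_pair a b).comp hinj.tendsto_cofinite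

protected theorem mul_add' (a b c : PerfLaurent p K) : a * (b + c) = a * b + a * c := by
  ext e
  simp only [coeff_mul, coeff_add, mul_add]
  exact (summable_mul a b e).tsum_add (summable_mul a c e)

protected theorem mul_assoc' (a b c : PerfLaurent p K) : a * b * c = a * (b * c) := by
  ext e
  have hs : Summable (Function.uncurry fun k j : ℚ =>
      a.coeff j * b.coeff (k - j) * c.coeff (e - k)) := by
    apply NonarchimedeanAddGroup.summable_of_tendsto_cofinite_zero
    have hinj : Function.Injective fun x : ℚ × ℚ => (x.2, x.1 - x.2, e - x.1) := by
      rintro ⟨x, y⟩ ⟨x', y'⟩ h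
      simp only [Prod.mk.injEq, sub_right_inj] at h
      rw [h.1, h.2.2]
    refine ((tendsto_triple a b c).comp hinj.tendsto_cofinite).congr fun x => ?_
    simp [Function.uncurry, mul_assoc]
  calc (a * b * c).coeff e
      = ∑' k : ℚ, ∑' j : ℚ, a.coeff j * b.coeff (k - j) * c.coeff (e - k) := by
        rw [coeff_mul]
        exact tsum_congr fun k => by rw [coeff_mul, tsum_mul_right]
    _ = ∑' j : ℚ, ∑' k : ℚ, a.coeff j * b.coeff (k - j) * c.coeff (e - k) := hs.tsum_comm.symm
    _ = (a * (b * c)).coeff e := by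
        rw [coeff_mul]
        refine tsum_congr fun j => ?_
        rw [coeff_mul, ← tsum_mul_left, ← (Equiv.addRight j).tsum_eq]
        refine tsum_congr fun k => ?_
        simp only [Equiv.coe_addRight, add_sub_cancel_right]
        rw [mul_assoc, show e - (k + j) = e - j - k by ring]

noncomputable instance : CommRing (PerfLaurent p K) where
  add_assoc a b c := by ext; simp [add_assoc]
  zero_add a := by ext; simp
  add_zero a := by ext; simp
  add_comm a b := by ext; simp [add_comm]
  neg_add_cancel a := by ext; simp
  nsmul := nsmulRec
  zsmul := zsmulRec
  mul_assoc := PerfLaurent.mul_assoc'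
  mul_comm := PerfLaurent.mul_comm'
  one_mul := PerfLaurent.one_mul'
  mul_one a := by rw [PerfLaurent.mul_comm', PerfLaurent.one_mul']
  left_distrib := PerfLaurent.mul_add'
  right_distrib a b c := by
    rw [PerfLaurent.mul_comm', PerfLaurent.mul_add', PerfLaurent.mul_comm' c,
      PerfLaurent.mul_comm' c]
  zero_mul a := by ext; simp [coeff_mul]
  mul_zero a := by ext; simp [coeff_mul]

/-- A non-zero series has a largest exponent at which the norm of the coefficient is maximal. -/
theorem exists_top (a : PerfLaurent p K) (ha : a ≠ 0) : ∃ e : ℚ, a.coeff e ≠ 0 ∧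
    (∀ k, ‖a.coeff k‖ ≤ ‖a.coeff e‖) ∧ ∀ k, e < k → ‖a.coeff k‖ < ‖a.coeff e‖ := by
  obtain ⟨e₀, he₀⟩ : ∃ e, a.coeff e ≠ 0 := by
    by_contra! h
    exact ha (by ext e; simpa using h e)
  have hfin : {k | ‖a.coeff e₀‖ ≤ ‖a.coeff k‖}.Finite := by
    have h := (tendsto_zero_iff_norm_tendsto_zero.mp a.tendsto_coeff).eventually
      (gt_mem_nhds (norm_pos_iff.mpr he₀))
    rw [eventually_cofinite] at h
    simpa using h
  obtain ⟨e₁, he₁, hmax⟩ := hfin.exists_maximalFor (fun k => ‖a.coeff k‖) _ ⟨e₀, le_refl ‖a.coeff e₀‖⟩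
  have hmax' : ∀ k, ‖a.coeff k‖ ≤ ‖a.coeff e₁‖ := fun k => by
    by_contra! hk
    exact absurd (hmax (le_trans he₁ hk.le : ‖a.coeff e₀‖ ≤ ‖a.coeff k‖) hk.le) (not_le.mpr hk)
  have hfin2 : {k | ‖a.coeff e₁‖ ≤ ‖a.coeff k‖}.Finite :=
    hfin.subset fun k (hk : ‖a.coeff e₁‖ ≤ ‖a.coeff k‖) =>
      (le_trans he₁ hk : ‖a.coeff e₀‖ ≤ ‖a.coeff k‖)
  obtain ⟨e₂, he₂, htop⟩ := hfin2.exists_maximalFor id _ ⟨e₁, le_refl ‖a.coeff e₁‖⟩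
  have he₂' : ‖a.coeff e₁‖ ≤ ‖a.coeff e₂‖ := he₂
  have he₁' : ‖a.coeff e₀‖ ≤ ‖a.coeff e₁‖ := he₁
  refine ⟨e₂, ?_, fun k => (hmax' k).trans he₂', fun k hk => ?_⟩
  · rw [← norm_pos_iff]
    exact (norm_pos_iff.mpr he₀).trans_le (he₁'.trans he₂')
  · by_contra! hcon
    exact absurd (htop (he₂'.trans hcon : ‖a.coeff e₁‖ ≤ ‖a.coeff k‖) hk.le) (not_le.mpr hk)

instance : Nontrivial (PerfLaurent p K) :=
  ⟨⟨0, 1, fun h => by simpa [coeff_one] using congrArg (fun a => a.coeff 0) h⟩⟩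

instance : NoZeroDivisors (PerfLaurent p K) where
  eq_zero_or_eq_zero_of_mul_eq_zero {a b} hab := by
    by_contra! h
    obtain ⟨x, hx0, hx1, hx2⟩ := exists_top a h.1
    obtain ⟨y, hy0, hy1, hy2⟩ := exists_top b h.2
    have hpos : 0 < ‖a.coeff x‖ * ‖b.coeff y‖ := by positivity
    have h0 : (a * b).coeff (x + y) = 0 := by rw [hab]; rfl
    rw [coeff_mul, (summable_mul a b (x + y)).tsum_eq_add_tsum_ite x] at h0
    simp only [add_sub_cancel_left] at h0
    have h1 := norm_tsum_lt_of_forall_ultra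
      (f := fun k => if k = x then 0 else a.coeff k * b.coeff (x + y - k)) hpos fun k => by
        rcases lt_trichotomy k x with hk | rfl | hk
        · have := hy2 (x + y - k) (by linarith)
          rw [if_neg hk.ne, norm_mul]
          exact mul_lt_mul' (hx1 k) this (norm_nonneg _) (by positivity)
        · simpa using hpos
        · rw [if_neg hk.ne', norm_mul]
          exact (mul_le_mul_of_nonneg_left (hy1 _) (norm_nonneg _)).trans_lt
            (mul_lt_mul_of_pos_right (hx2 k hk) (norm_pos_iff.mpr hy0))
    have h2 := eq_neg_of_add_eq_zero_right h0
    rw [h2, norm_neg, norm_mul] at h1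
    exact lt_irrefl _ h1

instance : IsDomain (PerfLaurent p K) := NoZeroDivisors.to_isDomain _

end PerfLaurent

namespace RootSystem

variable {p : ℕ} {K : Type*} [NontriviallyNormedField K]

/-- The element `q ^ e` of `K` for `e ∈ ℤ[1/p]` (irrelevant for other rational numbers `e`): for
`e = k / p ^ i` it is `seq i ^ k`, see `expo_div`. -/
def expo (q : RootSystem p K) (e : ℚ) : K := q.seq (padicValNat p e.den) ^ e.num

theorem seq_add_pow (q : RootSystem p K) (i j : ℕ) : q.seq (i + j) ^ p ^ j = q.seq i := by
  induction j with
  | zero => simp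
  | succ j ih => rw [pow_succ', pow_mul, ← add_assoc, q.compat, ih]

variable [Fact p.Prime]

theorem seq_ne_zero (q : RootSystem p K) (i : ℕ) : q.seq i ≠ 0 := fun h => by
  have h1 := q.seq_add_pow 0 i
  rw [zero_add, h, zero_pow (pow_ne_zero _ (Fact.out : p.Prime).ne_zero)] at h1
  exact q.ne_zero h1.symm

theorem expo_div (q : RootSystem p K) (k : ℤ) (i : ℕ) :
    q.expo (k / (p : ℚ) ^ i) = q.seq i ^ k := by
  have hp : p.Prime := Fact.out
  have hp0 : (p : ℚ) ≠ 0 := by exact_mod_cast hp.ne_zero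
  obtain ⟨e, he⟩ : ∃ e : ℚ, e = k / (p : ℚ) ^ i := ⟨_, rfl⟩
  rw [← he]
  have hdvd : e.den ∣ p ^ i := by
    have h := Rat.den_dvd k ((p : ℤ) ^ i)
    rw [Rat.divInt_eq_div] at h
    push_cast at h
    rw [← he] at h
    exact_mod_cast h
  obtain ⟨j, hj, hden⟩ := (Nat.dvd_prime_pow hp).mp hdvd
  obtain ⟨l, rfl⟩ := Nat.exists_eq_add_of_le hj
  have hk : k = p ^ l * e.num := by
    have h1 : (e.num : ℚ) / (p : ℚ) ^ j = e := by
      have := Rat.num_div_den e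
      rw [hden] at this
      exact_mod_cast this
    have h1 := h1.trans he
    rw [div_eq_div_iff (pow_ne_zero _ hp0) (pow_ne_zero _ hp0), pow_add] at h1
    have h2 : (k : ℚ) = (p : ℚ) ^ l * e.num := by
      have : (p : ℚ) ^ j ≠ 0 := pow_ne_zero _ hp0
      apply mul_left_cancel₀ this
      linear_combination -h1
    exact_mod_cast h2
  have h3 : q.seq (j + l) ^ k = q.seq j ^ e.num := by
    rw [← q.seq_add_pow j l, ← zpow_natCast, ← zpow_mul]
    rw [hk]
    norm_cast
  rw [h3, expo, hden, padicValNat.prime_pow]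

theorem norm_seq_zpow (q : RootSystem p K) (k : ℤ) (i : ℕ) :
    ‖q.seq i ^ k‖ = ‖q.seq 0‖ ^ (((k / (p : ℚ) ^ i : ℚ)) : ℝ) := by
  have hp0 : (p : ℝ) ≠ 0 := by exact_mod_cast (Fact.out : p.Prime).ne_zero
  have h := q.seq_add_pow 0 i
  rw [zero_add] at h
  rw [← h, norm_pow, norm_zpow, ← Real.rpow_natCast, ← Real.rpow_mul (norm_nonneg _),
    ← Real.rpow_intCast]
  congr 1
  push_cast
  field_simp

end RootSystem

namespace PerfLaurent

variable {p : ℕ} {K : Type*} [NontriviallyNormedField K] [Fact p.Prime]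

/-- The series `a(q⁻¹ X)`: the coefficient of `X ^ e` is multiplied by `q ^ (-e)`. -/
noncomputable def shift (q : RootSystem p K) (a : PerfLaurent p K) : PerfLaurent p K where
  coeff e := a.coeff e * (q.expo e)⁻¹
  bounded_denom := by
    obtain ⟨i, hi⟩ := a.bounded_denom
    exact ⟨i, fun e he => hi e (left_ne_zero_of_mul he)⟩
  converges r hr := by
    have hq : 0 < ‖q.seq 0‖ := norm_pos_iff.mpr q.ne_zero
    refine (a.converges (r / ‖q.seq 0‖) (by positivity)).congr fun e => ?_
    by_cases he : a.coeff e = 0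
    · simp [he]
    · obtain ⟨i, hi⟩ := a.bounded_denom
      obtain ⟨k, rfl⟩ := hi e he
      rw [q.expo_div, norm_mul, norm_inv, q.norm_seq_zpow, Real.div_rpow hr.le hq.le]
      field_simp

variable [IsUltrametricDist K] [CompleteSpace K]

/-- The substitution `X ↦ q⁻¹ X` as a ring homomorphism. -/
noncomputable def shiftHom (q : RootSystem p K) : PerfLaurent p K →+* PerfLaurent p K where
  toFun := shift q
  map_zero' := by ext; simp [shift]
  map_one' := by
    ext e
    by_cases he : e = 0
    · subst he; simp [shift, coeff_one, RootSystem.expo]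
    · simp [shift, coeff_one, he]
  map_add' a b := by ext; simp [shift, add_mul]
  map_mul' a b := by
    ext e
    change (∑' k : ℚ, a.coeff k * b.coeff (e - k)) * (q.expo e)⁻¹ =
      ∑' k : ℚ, a.coeff k * (q.expo k)⁻¹ * (b.coeff (e - k) * (q.expo (e - k))⁻¹)
    rw [← tsum_mul_right]
    refine tsum_congr fun k => ?_
    by_cases ha : a.coeff k = 0
    · simp [ha]
    by_cases hb : b.coeff (e - k) = 0
    · simp [hb]
    obtain ⟨i, hi, hj⟩ := common_denom a b (Fact.out : p.Prime).ne_zero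
    obtain ⟨m, hm⟩ := hi k ha
    obtain ⟨n, hn⟩ := hj _ hb
    have he : e = ((m + n : ℤ) : ℚ) / (p : ℚ) ^ i := by
      push_cast
      rw [add_div, ← hm, ← hn]
      ring
    have h : q.expo e = q.expo k * q.expo (e - k) := by
      rw [hn, hm, he, q.expo_div, q.expo_div, q.expo_div, zpow_add₀ (q.seq_ne_zero i)]
    rw [h, mul_inv]
    ring

theorem shiftHom_injective (q : RootSystem p K) :
    Function.Injective (shiftHom q : PerfLaurent p K →+* PerfLaurent p K) := by
  rw [injective_iff_map_eq_zero]
  intro a ha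
  ext e
  have h : a.coeff e * (q.expo e)⁻¹ = 0 := congrArg (fun b => b.coeff e) ha
  rcases mul_eq_zero.mp h with h | h
  · exact h
  · exact absurd h (inv_ne_zero (zpow_ne_zero _ (q.seq_ne_zero _)))

end PerfLaurent

/-- The field of meromorphic functions in `X ^ (1 / p ^ ∞)` over `K` on the punctured line:
quotients of everywhere convergent Laurent series. -/
abbrev PerfMero (p : ℕ) (K : Type*) [NontriviallyNormedField K] [IsUltrametricDist K]
    [CompleteSpace K] [Fact p.Prime] : Type _ :=
  FractionRing (PerfLaurent p K)

namespace PerfMero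

variable {p : ℕ} {K : Type*} [NontriviallyNormedField K] [IsUltrametricDist K]
  [CompleteSpace K] [Fact p.Prime]

/-- `f(q⁻¹ X)` for a meromorphic function `f`. -/
noncomputable def shift (q : RootSystem p K) : PerfMero p K →+* PerfMero p K :=
  IsFractionRing.map (PerfLaurent.shiftHom_injective q)

/-- `f` is `q`-periodic: `f(q⁻¹ X) = f(X)`. -/
def IsPeriodic (q : RootSystem p K) (f : PerfMero p K) : Prop :=
  shift q f = f

/-- The minimal polynomial `φ_α` of `α` over `K`, as a function of `X`. -/
noncomputable def phi (p : ℕ) [Fact p.Prime] (α : AlgebraicClosure K) : PerfLaurent p K :=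
  PerfLaurent.ofPolynomial (minpoly K α)

/-- `s` is a power of `φ_α` with exponent `m ∈ ℤ[1/p]`, `m ≥ 0`: one has `m = k / p ^ i` and
`s ^ (p ^ i) = φ_α ^ k`. -/
def IsPhiPower (α : AlgebraicClosure K) (m : ℚ) (s : PerfLaurent p K) : Prop :=
  ∃ i k : ℕ, m = k / (p : ℚ) ^ i ∧ s ^ p ^ i = phi p α ^ k

/-- `ord_α(g) = m` for a holomorphic function `g`: the number `m` is the highest exponent of a
power of `φ_α` that divides `g`. -/
def HolHasOrd (g : PerfLaurent p K) (α : AlgebraicClosure K) (m : ℚ) : Prop :=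
  IsGreatest {m' : ℚ | ∃ s : PerfLaurent p K, IsPhiPower α m' s ∧ s ∣ g} m

/-- `ord_α(f) = m` for a meromorphic function `f`: one has `ord_α(g) - ord_α(h) = m` for every
way to write `f = g / h`. -/
def HasOrd (f : PerfMero p K) (α : AlgebraicClosure K) (m : ℚ) : Prop :=
  ∀ g h : PerfLaurent p K, h ≠ 0 →
    f = algebraMap (PerfLaurent p K) (PerfMero p K) g / algebraMap (PerfLaurent p K) _ h →
    ∃ a b : ℚ, HolHasOrd g α a ∧ HolHasOrd h α b ∧ a - b = m

/-- `β` is a `K`-conjugate of `α` modulo the subgroup `{q ^ e | e ∈ ℤ[1/p]}` of `Kˣ`. -/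
def IsConjModQ (q : RootSystem p K) (α β : AlgebraicClosure K) : Prop :=
  ∃ γ : AlgebraicClosure K, IsConjRoot K α γ ∧
    ∃ (i : ℕ) (k : ℤ), β = algebraMap K (AlgebraicClosure K) (q.seq i ^ k) * γ

end PerfMero

/-! The function `f` is a quotient of theta functions. Let `φ` be the minimal polynomial of `α`, of
degree `d`. For a polynomial `P` of degree `d` with `P(0) ≠ 0`, the product of the `P(q ^ n X)` over
all integers `n`, with convergence factors, is a holomorphic `F` with `F(q⁻¹ X) = c X ^ d F(X)`,
where `c` is the leading coefficient of `P` divided by `P(0) q ^ d` (`exists_theta`). Applied to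
`φ(a ^ j X)` this gives `F_j` with a constant proportional to `a ^ (j d)`. Hence `F_0 F_2` and `F_1
^ 2` have the same multiplier, and `f = F_0 F_2 / F_1 ^ 2` is periodic.

Since the absolute value is not discrete, `a` can be chosen so that neither `|a|` nor `|a| ^ 2` can
be the norm of a scalar carrying a `q ^ ℤ`-translate of `α` or `β` to a conjugate of `α`
(`exists_norm_pow_mul_zpow_ne`). Then `F_1` and `F_2` are coprime to `φ_α` and to `φ_β`. On the
other hand `F_0 = φ_α Θ` with `Θ` coprime to `φ_α`, and `F_0` is coprime to `φ_β` if `β` is not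
conjugate to `α` modulo powers of `q`.

Coprimality always means a Bézout identity in the ring of holomorphic functions. It comes from two
facts. Division with remainder (`exists_eq_mul_add`) shows that an irreducible polynomial divides a
function with integral exponents or is coprime to it. The position of the dominant terms on circles,
that is, the Newton polygon, counts zeros in an annulus (`IsDominant.mul`, `IsDominant.le_of_le`);
it shows that the tail of an infinite product, being close to `1`, is not divisible by a given
polynomial.

A factor coprime to `φ_α` is coprime to each of its fractional powers, so it does not affect orders
(`holHasOrd_mul_iff`). What remains is that orders exist (`exists_holHasOrd`) and that
multiplication by `φ_α` raises them by one (`HolHasOrd.phi_mul`). In characteristic `p` the field is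
perfect and Frobenius is bijective on the ring, so everything reduces to a power `g ^ (p ^ i)` with
integral exponents. In characteristic zero the derivation `X d/dX` and separability of `φ_α` force
the exponents of its powers to be integers. -/

namespace PerfLaurent

/-! ### Monomials, polynomials and the inversion of the variable -/

section Basic

variable {p : ℕ} {K : Type*} [NontriviallyNormedField K] [Fact p.Prime] [IsUltrametricDist K]

/-- The monomial `c X ^ n` for an integer `n`. -/
def single (n : ℤ) (c : K) : PerfLaurent p K where
  coeff e := if e = n then c else 0
  bounded_denom := ⟨0, fun e he => ⟨n, by
    by_contra h
    exact he (if_neg (by simpa using h))⟩⟩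
  converges r _ := converges_of_finite ((Set.finite_singleton (n : ℚ)).subset fun e he => by
    by_contra h
    exact he (if_neg h)) r

theorem coeff_single (n : ℤ) (c : K) (e : ℚ) :
    (single n c : PerfLaurent p K).coeff e = if e = n then c else 0 := rfl

theorem coeff_single_mul (n : ℤ) (c : K) (g : PerfLaurent p K) (e : ℚ) :
    (single n c * g).coeff e = c * g.coeff (e - n) := by
  rw [coeff_mul, tsum_eq_single (n : ℚ) fun k hk => by simp [coeff_single, hk]]
  simp [coeff_single]

theorem single_mul_single (m n : ℤ) (a b : K) :
    (single m a * single n b : PerfLaurent p K) = single (m + n) (a * b) := by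
  ext e
  rw [coeff_single_mul, coeff_single, coeff_single]
  have : e - m = n ↔ e = ((m + n : ℤ) : ℚ) := by
    push_cast
    constructor <;> intro h <;> linarith
  simp [this]

theorem single_zero_one : (single 0 1 : PerfLaurent p K) = 1 := by
  ext e
  simp [coeff_single, coeff_one]

variable [CompleteSpace K]

/-- The constant functions. -/
def constHom : K →+* PerfLaurent p K where
  toFun := single 0
  map_one' := single_zero_one
  map_mul' a b := by rw [single_mul_single, add_zero]
  map_zero' := by ext; simp [coeff_single]
  map_add' a b := by
    ext e
    by_cases h : e = 0 <;> simp [coeff_single, h]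

noncomputable instance : Algebra K (PerfLaurent p K) := constHom.toAlgebra

theorem algebraMap_eq (c : K) : algebraMap K (PerfLaurent p K) c = single 0 c := rfl

theorem coeff_smul (c : K) (g : PerfLaurent p K) (e : ℚ) : (c • g).coeff e = c * g.coeff e := by
  rw [Algebra.smul_def, algebraMap_eq, coeff_single_mul]
  simp

theorem single_one_pow (n : ℕ) : (single 1 1 : PerfLaurent p K) ^ n = single n 1 := by
  induction n with
  | zero => simpa using single_zero_one.symm
  | succ n ih => rw [pow_succ, ih, single_mul_single]; simp

theorem isUnit_single (n : ℤ) {c : K} (hc : c ≠ 0) : IsUnit (single n c : PerfLaurent p K) :=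
  IsUnit.of_mul_eq_one (single (-n) c⁻¹) (by
    rw [single_mul_single, mul_inv_cancel₀ hc, add_neg_cancel, single_zero_one])

theorem coeff_sum {ι : Type*} (s : Finset ι) (f : ι → PerfLaurent p K) (e : ℚ) :
    (∑ i ∈ s, f i).coeff e = ∑ i ∈ s, (f i).coeff e := by
  induction s using Finset.cons_induction with
  | empty => simp
  | cons i s hi ih => rw [Finset.sum_cons, Finset.sum_cons, coeff_add, ih]

theorem coeff_ofPolynomial_intCast (P : K[X]) (n : ℤ) :
    (ofPolynomial P : PerfLaurent p K).coeff n = if 0 ≤ n then P.coeff n.toNat else 0 := by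
  simp [ofPolynomial]

theorem coeff_ofPolynomial_natCast (P : K[X]) (n : ℕ) :
    (ofPolynomial P : PerfLaurent p K).coeff n = P.coeff n := by
  simp [ofPolynomial]

theorem exists_natCast_of_coeff_ofPolynomial_ne_zero {P : K[X]} {e : ℚ}
    (h : (ofPolynomial P : PerfLaurent p K).coeff e ≠ 0) : ∃ n : ℕ, e = n := by
  have h' : e.den = 1 ∧ 0 ≤ e := by
    by_contra h'
    exact h (if_neg h')
  have h2 := (Rat.den_eq_one_iff e).mp h'.1
  obtain ⟨n, hn⟩ := Int.eq_ofNat_of_zero_le (Rat.num_nonneg.mpr h'.2)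
  exact ⟨n, by rw [← h2, hn]; simp⟩

theorem ofPolynomial_eq_aeval (P : K[X]) :
    (ofPolynomial P : PerfLaurent p K) = aeval (single 1 1) P := by
  induction P using Polynomial.induction_on' with
  | add P Q hP hQ =>
    rw [map_add, ← hP, ← hQ]
    ext e
    simp only [ofPolynomial, coeff_add, Polynomial.coeff_add]
    split_ifs <;> simp
  | monomial n c =>
    rw [aeval_monomial, single_one_pow, algebraMap_eq, single_mul_single, zero_add, mul_one]
    ext e
    rw [coeff_single]
    by_cases he : ∃ m : ℕ, e = m
    · obtain ⟨m, rfl⟩ := he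
      rw [coeff_ofPolynomial_natCast, Polynomial.coeff_monomial]
      simp [eq_comm]
    · rw [if_neg fun h => he ⟨n, by simpa using h⟩]
      by_contra h
      exact he (exists_natCast_of_coeff_ofPolynomial_ne_zero h)

theorem ofPolynomial_mul (P Q : K[X]) :
    (ofPolynomial (P * Q) : PerfLaurent p K) = ofPolynomial P * ofPolynomial Q := by
  simp [ofPolynomial_eq_aeval]

/-- A Bézout identity between polynomials persists under evaluation at the function `X`. -/
theorem isCoprime_ofPolynomial {P Q : K[X]} (h : IsCoprime P Q) :
    IsCoprime (ofPolynomial P : PerfLaurent p K) (ofPolynomial Q) := by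
  simp only [ofPolynomial_eq_aeval]
  exact h.map (aeval (single 1 1 : PerfLaurent p K)).toRingHom

theorem ofPolynomial_eq_sum (P : K[X]) : (ofPolynomial P : PerfLaurent p K) =
    ∑ j ∈ Finset.range (P.natDegree + 1), single j (P.coeff j) := by
  rw [ofPolynomial_eq_aeval, aeval_eq_sum_range]
  refine Finset.sum_congr rfl fun j _ => ?_
  rw [single_one_pow, Algebra.smul_def, algebraMap_eq, single_mul_single, zero_add, mul_one]

theorem coeff_ofPolynomial_mul (P : K[X]) (g : PerfLaurent p K) (e : ℚ) :
    (ofPolynomial P * g).coeff e =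
      ∑ j ∈ Finset.range (P.natDegree + 1), P.coeff j * g.coeff (e - j) := by
  rw [ofPolynomial_eq_sum, Finset.sum_mul, coeff_sum]
  exact Finset.sum_congr rfl fun j _ => by rw [coeff_single_mul]; simp

theorem ofPolynomial_ne_zero {P : K[X]} (hP : P ≠ 0) :
    (ofPolynomial P : PerfLaurent p K) ≠ 0 := fun h => by
  refine hP (Polynomial.ext fun n => ?_)
  rw [← coeff_ofPolynomial_natCast (p := p), h]
  simp

/-- The substitution `X ↦ X⁻¹`. -/
noncomputable def reflect : PerfLaurent p K →+* PerfLaurent p K where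
  toFun g :=
    { coeff := fun e => g.coeff (-e)
      bounded_denom := by
        obtain ⟨i, hi⟩ := g.bounded_denom
        refine ⟨i, fun e he => ?_⟩
        obtain ⟨k, hk⟩ := hi _ he
        exact ⟨-k, by push_cast; rw [neg_div, ← hk, neg_neg]⟩
      converges := fun r hr => by
        refine ((g.converges r⁻¹ (inv_pos.mpr hr)).comp
          (neg_injective (G := ℚ)).tendsto_cofinite).congr fun e => ?_
        simp [Real.inv_rpow hr.le, Real.rpow_neg hr.le] }
  map_one' := by ext e; simp [coeff_one]
  map_mul' a b := by
    ext e
    simp only [coeff_mul]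
    rw [← (Equiv.neg ℚ).tsum_eq]
    refine tsum_congr fun k => ?_
    simp only [Equiv.neg_apply]
    congr 2
    ring
  map_zero' := by ext; simp
  map_add' a b := by ext; simp

theorem coeff_reflect (g : PerfLaurent p K) (e : ℚ) : (reflect g).coeff e = g.coeff (-e) := rfl

/-- Lets the factors of a theta function with negative index be treated as a product in `X⁻¹` built
from the reversed polynomial; the two differ by a unit. -/
theorem reflect_reverse (P : K[X]) : reflect (ofPolynomial P.reverse : PerfLaurent p K) =
    single (-P.natDegree) 1 * ofPolynomial P := by
  ext e
  rw [coeff_single_mul, one_mul, coeff_reflect]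
  by_cases he : ∃ n : ℤ, e = n
  · obtain ⟨n, rfl⟩ := he
    have h1 : (-(n : ℚ)) = ((-n : ℤ) : ℚ) := by push_cast; rfl
    have h2 : (n : ℚ) - ((-(P.natDegree : ℤ) : ℤ) : ℚ) = ((n + P.natDegree : ℤ) : ℚ) := by
      push_cast; ring
    rw [h1, h2, coeff_ofPolynomial_intCast, coeff_ofPolynomial_intCast]
    split_ifs with h3 h4 h4
    · rw [Polynomial.coeff_reverse, Polynomial.revAt_le (by omega)]
      congr 1
      omega
    · rw [Polynomial.coeff_reverse, Polynomial.revAt_eq_self_of_lt (by omega)]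
      exact Polynomial.coeff_eq_zero_of_natDegree_lt (by omega)
    · exact (Polynomial.coeff_eq_zero_of_natDegree_lt (by omega)).symm
    · rfl
  · have h1 : (ofPolynomial P.reverse : PerfLaurent p K).coeff (-e) = 0 := by
      by_contra h
      obtain ⟨n, hn⟩ := exists_natCast_of_coeff_ofPolynomial_ne_zero h
      exact he ⟨-n, by push_cast; linarith⟩
    have h2 : (ofPolynomial P : PerfLaurent p K).coeff (e - ((-(P.natDegree : ℤ) : ℤ) : ℚ)) = 0 := by
      by_contra h
      obtain ⟨n, hn⟩ := exists_natCast_of_coeff_ofPolynomial_ne_zero h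
      exact he ⟨n - P.natDegree, by push_cast at hn ⊢; linarith⟩
    rw [h1, h2]

end Basic

end PerfLaurent

/-! ### The shift and its inverse on coefficients and polynomials -/

namespace RootSystem

variable {p : ℕ} {K : Type*} [NontriviallyNormedField K]

/-- The root system of `q⁻¹`. -/
def inv (q : RootSystem p K) : RootSystem p K where
  seq i := (q.seq i)⁻¹
  ne_zero := inv_ne_zero q.ne_zero
  compat i := by rw [inv_pow, q.compat]

theorem expo_inv (q : RootSystem p K) (e : ℚ) : q.inv.expo e = (q.expo e)⁻¹ := by
  simp [expo, inv]

theorem expo_neg (q : RootSystem p K) (e : ℚ) : q.expo (-e) = (q.expo e)⁻¹ := by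
  simp [expo]

theorem expo_intCast (q : RootSystem p K) (n : ℤ) : q.expo n = q.seq 0 ^ n := by
  simp [expo]

theorem expo_ne_zero [Fact p.Prime] (q : RootSystem p K) (e : ℚ) : q.expo e ≠ 0 :=
  zpow_ne_zero _ (q.seq_ne_zero _)

end RootSystem

namespace PerfLaurent

variable {p : ℕ} {K : Type*} [NontriviallyNormedField K] [Fact p.Prime] [IsUltrametricDist K]
  [CompleteSpace K]

theorem coeff_shiftHom (q : RootSystem p K) (g : PerfLaurent p K) (e : ℚ) :
    (shiftHom q g).coeff e = g.coeff e * (q.expo e)⁻¹ := rfl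

theorem shiftHom_shiftHom_inv (q : RootSystem p K) (g : PerfLaurent p K) :
    shiftHom q (shiftHom q.inv g) = g := by
  ext e
  rw [coeff_shiftHom, coeff_shiftHom, q.expo_inv, inv_inv,
    mul_inv_cancel_right₀ (q.expo_ne_zero e)]

/-- Inverting `X` exchanges scaling by `q⁻¹` with scaling by `q`. -/
theorem shiftHom_reflect (q : RootSystem p K) (g : PerfLaurent p K) :
    shiftHom q (reflect g) = reflect (shiftHom q.inv g) := by
  ext e
  rw [coeff_shiftHom, coeff_reflect, coeff_reflect, coeff_shiftHom, q.expo_inv, q.expo_neg, inv_inv]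

theorem shiftHom_single (q : RootSystem p K) (n : ℤ) (c : K) :
    shiftHom q (single n c) = single n (c * (q.seq 0 ^ n)⁻¹) := by
  ext e
  rw [coeff_shiftHom, coeff_single, coeff_single]
  split_ifs with h
  · rw [h, q.expo_intCast]
  · simp

theorem shiftHom_ofPolynomial (q : RootSystem p K) (P : K[X]) :
    shiftHom q (ofPolynomial P) = ofPolynomial (P.comp (C (q.seq 0)⁻¹ * X)) := by
  ext e
  rw [coeff_shiftHom]
  by_cases he : ∃ n : ℕ, e = n
  · obtain ⟨n, rfl⟩ := he
    have := q.expo_intCast n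
    rw [Int.cast_natCast] at this
    rw [coeff_ofPolynomial_natCast, coeff_ofPolynomial_natCast, Polynomial.comp_C_mul_X_coeff, this,
      zpow_natCast, inv_pow]
  · have h (Q : K[X]) : (ofPolynomial Q : PerfLaurent p K).coeff e = 0 := by
      by_contra h
      exact he (exists_natCast_of_coeff_ofPolynomial_ne_zero h)
    rw [h, h, zero_mul]

theorem shiftHom_iterate_ofPolynomial (q : RootSystem p K) (n : ℕ) (P : K[X]) :
    (shiftHom q)^[n] (ofPolynomial P) = ofPolynomial (P.comp (C ((q.seq 0)⁻¹ ^ n) * X)) := by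
  induction n with
  | zero => simp
  | succ n ih =>
    rw [Function.iterate_succ_apply', ih, shiftHom_ofPolynomial, Polynomial.comp_assoc]
    congr 2
    simp only [mul_comp, C_comp, X_comp, pow_succ, map_mul]
    ring

theorem coeff_shiftHom_iterate (q : RootSystem p K) (n : ℕ) (g : PerfLaurent p K) (e : ℚ) :
    ((shiftHom q)^[n] g).coeff e = g.coeff e * (q.expo e)⁻¹ ^ n := by
  induction n with
  | zero => simp
  | succ n ih => rw [Function.iterate_succ_apply', coeff_shiftHom, ih, pow_succ, mul_assoc]

theorem shiftHom_iterate_reflect (q : RootSystem p K) (n : ℕ) (g : PerfLaurent p K) :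
    (shiftHom q)^[n] (reflect g) = reflect ((shiftHom q.inv)^[n] g) := by
  induction n with
  | zero => rfl
  | succ n ih => rw [Function.iterate_succ_apply', ih, shiftHom_reflect, Function.iterate_succ_apply']

end PerfLaurent

/-! ### Dominant terms on circles and the number of zeros in an annulus -/

namespace PerfLaurent

variable {p : ℕ} {K : Type*} [NontriviallyNormedField K]

/-- The norm of the term of exponent `e` on the circle `|X| = r`. -/
noncomputable def termNorm (r : ℝ) (g : PerfLaurent p K) (e : ℚ) : ℝ := ‖g.coeff e‖ * r ^ (e : ℝ)

/-- The term of exponent `e` is the largest one on the circle `|X| = r`, and strictly larger than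
those whose exponent `k` satisfies `ε * e < ε * k`. For `ε = 1` this says that `e` is the last
exponent where the maximum is attained, for `ε = -1` that it is the first one. -/
structure IsDominant (r : ℝ) (ε : ℚ) (g : PerfLaurent p K) (e : ℚ) : Prop where
  ne_zero : g.coeff e ≠ 0
  le : ∀ k, termNorm r g k ≤ termNorm r g e
  lt : ∀ k, ε * e < ε * k → termNorm r g k < termNorm r g e

theorem termNorm_nonneg {r : ℝ} (hr : 0 < r) (g : PerfLaurent p K) (e : ℚ) : 0 ≤ termNorm r g e :=
  mul_nonneg (norm_nonneg _) (Real.rpow_nonneg hr.le _)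

theorem IsDominant.pos {r : ℝ} (hr : 0 < r) {ε : ℚ} {g : PerfLaurent p K} {e : ℚ}
    (h : IsDominant r ε g e) : 0 < termNorm r g e :=
  mul_pos (norm_pos_iff.mpr h.ne_zero) (Real.rpow_pos_of_pos hr _)

theorem IsDominant.unique {r : ℝ} {ε : ℚ} (hε : ε ≠ 0) {g : PerfLaurent p K} {e e' : ℚ}
    (h : IsDominant r ε g e) (h' : IsDominant r ε g e') : e = e' := by
  rcases lt_trichotomy (ε * e) (ε * e') with hlt | heq | hlt
  · exact absurd (h.lt _ hlt) (not_lt.mpr (h'.le e))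
  · exact mul_left_cancel₀ hε heq
  · exact absurd (h'.lt _ hlt) (not_lt.mpr (h.le e'))

/-- The terms tend to zero on the circle, so only finitely many compete: first the norm is
maximized, then `ε * e` among the maximal ones. -/
theorem exists_isDominant {r : ℝ} (hr : 0 < r) (ε : ℚ) {g : PerfLaurent p K}
    (hg : ∃ e, g.coeff e ≠ 0) : ∃ e, IsDominant r ε g e := by
  obtain ⟨e₀, he₀⟩ := hg
  have hpos : 0 < termNorm r g e₀ := mul_pos (norm_pos_iff.mpr he₀) (Real.rpow_pos_of_pos hr _)
  have hfin : {k | termNorm r g e₀ ≤ termNorm r g k}.Finite := by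
    have h := (g.converges r hr).eventually (gt_mem_nhds hpos)
    rw [eventually_cofinite] at h
    simpa [termNorm] using h
  obtain ⟨e₁, he₁, hmax⟩ := hfin.exists_maximalFor (termNorm r g) _ ⟨e₀, le_refl (termNorm r g e₀)⟩
  have hmax' : ∀ k, termNorm r g k ≤ termNorm r g e₁ := fun k => by
    by_contra! hk
    exact absurd (hmax (le_trans he₁ hk.le : termNorm r g e₀ ≤ termNorm r g k) hk.le) (not_le.mpr hk)
  have hfin2 : {k | termNorm r g e₁ ≤ termNorm r g k}.Finite :=
    hfin.subset fun k (hk : termNorm r g e₁ ≤ termNorm r g k) =>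
      (le_trans he₁ hk : termNorm r g e₀ ≤ termNorm r g k)
  obtain ⟨e₂, he₂, htop⟩ := hfin2.exists_maximalFor (fun e => ε * e) _ ⟨e₁, le_refl (termNorm r g e₁)⟩
  have he₂' : termNorm r g e₁ ≤ termNorm r g e₂ := he₂
  have he₁' : termNorm r g e₀ ≤ termNorm r g e₁ := he₁
  refine ⟨e₂, fun h0 => ?_, fun k => (hmax' k).trans he₂', fun k hk => ?_⟩
  · have := hpos.trans_le (he₁'.trans he₂')
    simp [termNorm, h0] at this
  · by_contra! hcon
    exact absurd (htop (he₂'.trans hcon : termNorm r g e₁ ≤ termNorm r g k) hk.le) (not_le.mpr hk)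

/-- The number of zeros in the annulus `r ≤ |X| ≤ R` is not negative. -/
theorem IsDominant.le_of_le {r R : ℝ} (hr : 0 < r) (hrR : r ≤ R) {g : PerfLaurent p K} {b t : ℚ}
    (hb : IsDominant r (-1) g b) (ht : IsDominant R 1 g t) : b ≤ t := by
  by_contra! hlt
  have hR := hr.trans_le hrR
  have h1 := ht.lt b (by linarith)
  have h2 := hb.lt t (by linarith)
  have hpb := hb.pos hr
  have hpt := ht.pos hR
  unfold termNorm at *
  -- After cancelling the coefficients the product of both inequalities reads `R ^ b * r ^ t < R ^ t
  -- * r ^ b`, which is impossible for `r ≤ R` and `t < b`.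
  have h3 := mul_lt_mul'' h1 h2 (by positivity) (by positivity)
  have hnb : 0 < ‖g.coeff b‖ := norm_pos_iff.mpr hb.ne_zero
  have hnt : 0 < ‖g.coeff t‖ := norm_pos_iff.mpr ht.ne_zero
  have h4 : (‖g.coeff b‖ * ‖g.coeff t‖) * (R ^ (b : ℝ) * r ^ (t : ℝ)) <
      (‖g.coeff b‖ * ‖g.coeff t‖) * (R ^ (t : ℝ) * r ^ (b : ℝ)) := by
    calc _ = _ := by ring
      _ < _ := h3
      _ = _ := by ring
  have h5 := lt_of_mul_lt_mul_left h4 (by positivity)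
  have h6 : r ^ ((b : ℝ) - t) ≤ R ^ ((b : ℝ) - t) :=
    Real.rpow_le_rpow hr.le hrR (sub_nonneg.mpr (by exact_mod_cast hlt.le))
  rw [Real.rpow_sub hr, Real.rpow_sub hR, div_le_div_iff₀ (by positivity) (by positivity)] at h6
  linarith

variable [Fact p.Prime] [IsUltrametricDist K] [CompleteSpace K]

theorem exists_coeff_ne_zero {g : PerfLaurent p K} (hg : g ≠ 0) : ∃ e, g.coeff e ≠ 0 := by
  by_contra! h
  exact hg (by ext e; simpa using h e)

/-- The Gauss lemma: in the Cauchy product at `x + y` the term with indices `x`, `y` is strictly the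
largest, so by the ultrametric inequality it determines the norm. Since dominant exponents add, so
do the zero counts of factors. -/
theorem IsDominant.mul {r : ℝ} (hr : 0 < r) {ε : ℚ} (hε : ε ≠ 0) {g h : PerfLaurent p K} {x y : ℚ}
    (hx : IsDominant r ε g x) (hy : IsDominant r ε h y) : IsDominant r ε (g * h) (x + y) := by
  have hA := hx.pos hr
  have hB := hy.pos hr
  have hterm (k j : ℚ) : ‖g.coeff j * h.coeff (k - j)‖ =
      termNorm r g j * termNorm r h (k - j) / r ^ (k : ℝ) := by
    have h3 : r ^ (k : ℝ) = r ^ (j : ℝ) * r ^ ((k - j : ℚ) : ℝ) := by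
      rw [← Real.rpow_add hr]
      push_cast
      ring_nf
    have := Real.rpow_pos_of_pos hr (j : ℝ)
    have := Real.rpow_pos_of_pos hr ((k - j : ℚ) : ℝ)
    rw [h3, termNorm, termNorm, norm_mul]
    field_simp
  have hxy : ‖(g * h).coeff (x + y)‖ = termNorm r g x * termNorm r h y / r ^ ((x + y : ℚ) : ℝ) := by
    rw [coeff_mul, (summable_mul g h (x + y)).tsum_eq_add_tsum_ite x]
    have h0 := hterm (x + y) x
    rw [add_sub_cancel_left] at h0 ⊢
    have h1 : ‖∑' k, if k = x then 0 else g.coeff k * h.coeff (x + y - k)‖ <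
        ‖g.coeff x * h.coeff y‖ := by
      refine norm_tsum_lt_of_forall_ultra (norm_pos_iff.mpr
        (mul_ne_zero hx.ne_zero hy.ne_zero)) fun k => ?_
      split_ifs with hk
      · rw [norm_zero]
        exact norm_pos_iff.mpr (mul_ne_zero hx.ne_zero hy.ne_zero)
      · rw [hterm, h0]
        refine div_lt_div_of_pos_right ?_ (Real.rpow_pos_of_pos hr _)
        -- The exponents `k` and `x + y - k` have a fixed sum, so for `k ≠ x` one of them lies
        -- beyond its dominant position in the direction of `ε`, and that factor gives strictness.
        rcases lt_or_gt_of_ne (fun h => hk (mul_left_cancel₀ hε h) : ε * k ≠ ε * x) with hk | hk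
        · exact mul_lt_mul' (hx.le k) (hy.lt _ (by rw [mul_sub, mul_add]; linarith))
            (termNorm_nonneg hr _ _) hA
        · exact (mul_le_mul_of_nonneg_left (hy.le _) (termNorm_nonneg hr _ _)).trans_lt
            (mul_lt_mul_of_pos_right (hx.lt k hk) hB)
    rw [IsUltrametricDist.norm_add_eq_max_of_norm_ne_norm h1.ne', max_eq_left h1.le, h0]
  have hxy' : termNorm r (g * h) (x + y) = termNorm r g x * termNorm r h y := by
    rw [termNorm, hxy, div_mul_cancel₀ _ (Real.rpow_pos_of_pos hr _).ne']
  refine ⟨?_, fun k => ?_, fun k hk => ?_⟩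
  · rw [← norm_pos_iff, hxy]
    have := Real.rpow_pos_of_pos hr ((x + y : ℚ) : ℝ)
    positivity
  · rw [hxy', termNorm, ← le_div_iff₀ (Real.rpow_pos_of_pos hr _), coeff_mul]
    have := Real.rpow_pos_of_pos hr (k : ℝ)
    refine norm_tsum_le_of_forall_ultra (by positivity) fun j => ?_
    rw [hterm]
    exact div_le_div_of_nonneg_right (mul_le_mul (hx.le j) (hy.le _) (termNorm_nonneg hr _ _)
      hA.le) this.le
  · rw [hxy', termNorm, ← lt_div_iff₀ (Real.rpow_pos_of_pos hr _), coeff_mul]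
    have := Real.rpow_pos_of_pos hr (k : ℝ)
    refine norm_tsum_lt_of_forall_ultra (by positivity) fun j => ?_
    rw [hterm]
    refine div_lt_div_of_pos_right ?_ this
    by_cases hj : ε * x < ε * j
    · exact (mul_le_mul_of_nonneg_left (hy.le _) (termNorm_nonneg hr _ _)).trans_lt
        (mul_lt_mul_of_pos_right (hx.lt j hj) hB)
    · exact mul_lt_mul' (hx.le j) (hy.lt _ (by rw [mul_sub]; rw [mul_add] at hk; linarith))
        (termNorm_nonneg hr _ _) hA

theorem isDominant_one {r : ℝ} (ε : ℚ) : IsDominant r ε (1 : PerfLaurent p K) 0 := by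
  refine ⟨by simp [coeff_one], fun k => ?_, fun k hk => ?_⟩
  · by_cases hk : k = 0 <;> simp [termNorm, coeff_one, hk]
  · have : k ≠ 0 := by rintro rfl; simp at hk
    simp [termNorm, coeff_one, this]

theorem IsDominant.pow {r : ℝ} (hr : 0 < r) {ε : ℚ} (hε : ε ≠ 0) {g : PerfLaurent p K} {x : ℚ}
    (hx : IsDominant r ε g x) (n : ℕ) : IsDominant r ε (g ^ n) (n * x) := by
  induction n with
  | zero => simpa using isDominant_one ε
  | succ n ih =>
    rw [pow_succ]
    have := ih.mul hr hε hx
    rwa [show (n : ℚ) * x + x = ((n + 1 : ℕ) : ℚ) * x by push_cast; ring] at this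

/-- All roots of a polynomial with `P(0) ≠ 0` lie in an annulus `r ≤ |X| ≤ R`. -/
theorem exists_isDominant_ofPolynomial {P : K[X]} (hP : P.coeff 0 ≠ 0) : ∃ r R : ℝ, 0 < r ∧ r ≤ R ∧
    IsDominant r (-1) (ofPolynomial P : PerfLaurent p K) 0 ∧
    IsDominant R 1 (ofPolynomial P : PerfLaurent p K) P.natDegree := by
  have hP0 : P ≠ 0 := by rintro rfl; simp at hP
  have hlead : P.coeff P.natDegree ≠ 0 := leadingCoeff_ne_zero.mpr hP0
  set B : ℝ := ∑ j ∈ Finset.range (P.natDegree + 1), ‖P.coeff j‖ with hB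
  have hBle (j : ℕ) : ‖P.coeff j‖ ≤ B := by
    by_cases hj : j ≤ P.natDegree
    · exact Finset.single_le_sum (f := fun j => ‖P.coeff j‖) (fun _ _ => norm_nonneg _)
        (Finset.mem_range.mpr (by omega))
    · rw [Polynomial.coeff_eq_zero_of_natDegree_lt (by omega), norm_zero]
      exact Finset.sum_nonneg fun _ _ => norm_nonneg _
  have hBpos : 0 < B := (norm_pos_iff.mpr hP).trans_le (hBle 0)
  have h0pos := norm_pos_iff.mpr hP
  have hlpos := norm_pos_iff.mpr hlead
  have hc (e : ℚ) (he : ¬ ∃ n : ℕ, e = n) (r : ℝ) :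
      termNorm r (ofPolynomial P : PerfLaurent p K) e = 0 := by
    by_cases h : (ofPolynomial P : PerfLaurent p K).coeff e = 0
    · simp [termNorm, h]
    · exact absurd (exists_natCast_of_coeff_ofPolynomial_ne_zero h) he
  have ht (n : ℕ) (r : ℝ) : termNorm r (ofPolynomial P : PerfLaurent p K) n =
      ‖P.coeff n‖ * r ^ n := by
    rw [termNorm, coeff_ofPolynomial_natCast, Rat.cast_natCast, Real.rpow_natCast]
  have ht0 (r : ℝ) : termNorm r (ofPolynomial P : PerfLaurent p K) 0 = ‖P.coeff 0‖ := by
    simpa using ht 0 r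
  have hc0 : (ofPolynomial P : PerfLaurent p K).coeff 0 = P.coeff 0 := by
    simpa using coeff_ofPolynomial_natCast (p := p) P 0
  -- The radii are chosen so that `B * r ≤ ‖P.coeff 0‖` and that `B` is at most `R` times the norm
  -- of the leading coefficient. The comparison with `1` makes powers of `r` decrease and powers of
  -- `R` increase.
  set r : ℝ := min 1 (‖P.coeff 0‖ / B) with hr
  set R : ℝ := max 1 (B / ‖P.coeff P.natDegree‖ + 1) with hR
  have hr0 : 0 < r := lt_min one_pos (div_pos h0pos hBpos)
  have hR0 : 0 < R := lt_max_of_lt_left one_pos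
  refine ⟨r, R, hr0, (min_le_left _ _).trans (le_max_left _ _),
    ⟨by rwa [hc0], fun k => ?_, fun k hk => ?_⟩, ⟨?_, fun k => ?_, fun k hk => ?_⟩⟩
  · by_cases hk : ∃ n : ℕ, k = n
    · obtain ⟨n, rfl⟩ := hk
      rw [ht, ht0]
      rcases Nat.eq_zero_or_pos n with rfl | hn
      · simp
      · calc ‖P.coeff n‖ * r ^ n ≤ B * r := by
              refine mul_le_mul (hBle n) (pow_le_of_le_one hr0.le (min_le_left _ _) hn.ne')
                (by positivity) hBpos.le
          _ ≤ B * (‖P.coeff 0‖ / B) := by gcongr; exact min_le_right _ _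
          _ = _ := by field_simp
    · rw [hc k hk]
      exact termNorm_nonneg hr0 _ _
  · rw [hc k, ht0]
    · exact h0pos
    · rintro ⟨n, rfl⟩
      have : (0 : ℚ) ≤ n := n.cast_nonneg
      linarith
  · rwa [coeff_ofPolynomial_natCast]
  · by_cases hk : ∃ n : ℕ, k = n
    · obtain ⟨n, rfl⟩ := hk
      rw [ht, ht]
      rcases lt_trichotomy n P.natDegree with hn | hn | hn
      · obtain ⟨m, hm⟩ := Nat.exists_eq_add_of_lt hn
        calc ‖P.coeff n‖ * R ^ n ≤ (‖P.coeff P.natDegree‖ * R) * R ^ n := by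
              refine mul_le_mul_of_nonneg_right ((hBle n).trans ?_) (by positivity)
              rw [← div_le_iff₀' hlpos]
              exact (by linarith : B / ‖P.coeff P.natDegree‖ ≤
                B / ‖P.coeff P.natDegree‖ + 1).trans (le_max_right _ _)
          _ = ‖P.coeff P.natDegree‖ * R ^ (n + 1) := by ring
          _ ≤ _ := by
              gcongr
              · exact le_max_left _ _
              · omega
      · rw [hn]
      · rw [Polynomial.coeff_eq_zero_of_natDegree_lt hn]
        simp only [norm_zero, zero_mul]
        positivity
    · rw [hc k hk]
      exact termNorm_nonneg hR0 _ _
  · have h1 : 0 < termNorm R (ofPolynomial P : PerfLaurent p K) P.natDegree := by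
      rw [ht]; positivity
    by_cases hk' : ∃ n : ℕ, k = n
    · obtain ⟨n, rfl⟩ := hk'
      have : P.natDegree < n := by
        have : (P.natDegree : ℚ) < n := by linarith
        exact_mod_cast this
      rw [ht n, Polynomial.coeff_eq_zero_of_natDegree_lt this]
      simpa using h1
    · rwa [hc k hk']

/-- In a nonzero function, the multiplicity of a nonconstant polynomial is bounded. -/
theorem exists_not_pow_dvd {P : K[X]} (hP : P.coeff 0 ≠ 0) (hd : P.natDegree ≠ 0)
    {g : PerfLaurent p K} (hg : g ≠ 0) : ∃ N : ℕ, ∀ n, ofPolynomial P ^ n ∣ g → n ≤ N := by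
  obtain ⟨r, R, hr, hrR, hbot, htop⟩ := exists_isDominant_ofPolynomial (p := p) hP
  have hR := hr.trans_le hrR
  obtain ⟨b, hb⟩ := exists_isDominant hr (-1) (exists_coeff_ne_zero hg)
  obtain ⟨t, ht⟩ := exists_isDominant hR 1 (exists_coeff_ne_zero hg)
  -- `t - b` is the number of zeros of `g` in the annulus. Each factor `P` uses up `P.natDegree` of
  -- them and the cofactor has a nonnegative number.
  obtain ⟨N, hN⟩ := exists_nat_ge (t - b)
  refine ⟨N, fun n ⟨h, hh⟩ => ?_⟩
  have hh0 : h ≠ 0 := by rintro rfl; exact hg (by simpa using hh)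
  obtain ⟨b', hb'⟩ := exists_isDominant hr (-1) (exists_coeff_ne_zero hh0)
  obtain ⟨t', ht'⟩ := exists_isDominant hR 1 (exists_coeff_ne_zero hh0)
  have h1 := (hbot.pow hr (by norm_num) n).mul hr (by norm_num) hb'
  have h2 := (htop.pow hR one_ne_zero n).mul hR one_ne_zero ht'
  rw [← hh] at h1 h2
  have h3 := hb.unique (by norm_num) h1
  have h4 := ht.unique one_ne_zero h2
  have h5 := hb'.le_of_le hr hrR ht'
  have h6 : (n : ℚ) * 1 ≤ n * P.natDegree := by
    gcongr
    exact_mod_cast Nat.one_le_iff_ne_zero.mpr hd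
  have h7 : (n : ℚ) ≤ N := by linarith
  exact_mod_cast h7

theorem not_isUnit_ofPolynomial {P : K[X]} (hP : P.coeff 0 ≠ 0) (hd : P.natDegree ≠ 0) :
    ¬ IsUnit (ofPolynomial P : PerfLaurent p K) := fun h => by
  obtain ⟨N, hN⟩ := exists_not_pow_dvd (p := p) hP hd one_ne_zero
  exact absurd (hN (N + 1) (h.pow _).dvd) (by omega)

/-- A function that is close to `1` on the annulus that contains the roots of `P` is not divisible
by `P`. -/
theorem not_ofPolynomial_dvd {P : K[X]} (hd : P.natDegree ≠ 0) {r R : ℝ} (hr : 0 < r) (hrR : r ≤ R)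
    (hbot : IsDominant r (-1) (ofPolynomial P : PerfLaurent p K) 0)
    (htop : IsDominant R 1 (ofPolynomial P : PerfLaurent p K) P.natDegree)
    {g : PerfLaurent p K} (hg0 : g.coeff 0 = 1) (hgr : ∀ e ≠ 0, termNorm r g e < 1)
    (hgR : ∀ e ≠ 0, termNorm R g e < 1) : ¬ ofPolynomial P ∣ g := by
  rintro ⟨h, rfl⟩
  have hh0 : h ≠ 0 := by rintro rfl; simp at hg0
  have hdom {r : ℝ} (ε : ℚ) (H : ∀ e ≠ 0, termNorm r (ofPolynomial P * h) e < 1) :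
      IsDominant r ε (ofPolynomial P * h) 0 := by
    have h1 : termNorm r (ofPolynomial P * h) 0 = 1 := by simp [termNorm, hg0]
    refine ⟨by simp [hg0], fun k => ?_, fun k hk => ?_⟩
    · rcases eq_or_ne k 0 with rfl | hk
      · exact le_rfl
      · exact h1 ▸ (H k hk).le
    · exact h1 ▸ H k (by rintro rfl; simp at hk)
  have hR := hr.trans_le hrR
  obtain ⟨b', hb'⟩ := exists_isDominant hr (-1) (exists_coeff_ne_zero hh0)
  obtain ⟨t', ht'⟩ := exists_isDominant hR 1 (exists_coeff_ne_zero hh0)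
  -- A function dominated by its constant term on both circles has no zeros between them. For the
  -- cofactor this gives `b' = 0` and `t' = -P.natDegree`, contradicting `b' ≤ t'`.
  have h3 := (hdom (-1) hgr).unique (by norm_num) (hbot.mul hr (by norm_num) hb')
  have h4 := (hdom 1 hgR).unique one_ne_zero (htop.mul hR one_ne_zero ht')
  have h5 := hb'.le_of_le hr hrR ht'
  have h6 : (0 : ℚ) < P.natDegree := by exact_mod_cast Nat.pos_of_ne_zero hd
  linarith

end PerfLaurent

namespace PerfLaurent

/-! ### Series with integral exponents and inverse power series -/

section Decay

variable {p : ℕ} {K : Type*} [NontriviallyNormedField K]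

/-- The coefficients of a Laurent series with integral exponents that converges everywhere. -/
def RapidDecay (a : ℤ → K) : Prop := ∀ r : ℝ, 1 ≤ r → ∃ M : ℝ, ∀ n, ‖a n‖ * r ^ n.natAbs ≤ M

/-- The quantity to be bounded increases with `r ≥ 1`. In applications `C` is the growth rate of an
auxiliary series. -/
theorem RapidDecay.of_ge {a : ℤ → K} (C : ℝ)
    (h : ∀ r : ℝ, 1 ≤ r → C ≤ r → ∃ M : ℝ, ∀ n, ‖a n‖ * r ^ n.natAbs ≤ M) : RapidDecay a := by
  intro r hr
  obtain ⟨M, hM⟩ := h (max r C) (le_max_of_le_left hr) (le_max_right _ _)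
  exact ⟨M, fun n => le_trans (by gcongr; exact le_max_left _ _) (hM n)⟩

/-- The bound at radius `2 r` yields a factor `2 ^ (-|n|)` at radius `r`. -/
theorem RapidDecay.tendsto {a : ℤ → K} (ha : RapidDecay a) {r : ℝ} (hr : 1 ≤ r) :
    Tendsto (fun n => ‖a n‖ * r ^ n.natAbs) cofinite (𝓝 0) := by
  obtain ⟨M, hM⟩ := ha (r * 2) (by linarith)
  have h1 : Tendsto Int.natAbs cofinite atTop := by
    rw [← Nat.cofinite_eq_atTop]
    refine Tendsto.cofinite_of_finite_preimage_singleton fun k => ?_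
    refine (Set.toFinite {(k : ℤ), -(k : ℤ)}).subset fun n hn => ?_
    have : n.natAbs = k := hn
    simp only [Set.mem_insert_iff, Set.mem_singleton_iff]
    omega
  have h2 : Tendsto (fun n : ℤ => M * (1 / 2 : ℝ) ^ n.natAbs) cofinite (𝓝 0) := by
    have := (tendsto_pow_atTop_nhds_zero_of_lt_one (r := (1 / 2 : ℝ)) (by norm_num)
      (by norm_num)).comp h1
    simpa using this.const_mul M
  refine squeeze_zero (fun n => by positivity) (fun n => ?_) h2
  have := hM n
  rw [mul_pow, ← mul_assoc] at this
  rw [one_div, inv_pow, ← div_eq_mul_inv, le_div_iff₀ (by positivity)]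
  exact this

/-- The function with given integral exponents and rapidly decaying coefficients. -/
noncomputable def ofInt (a : ℤ → K) (ha : RapidDecay a) : PerfLaurent p K where
  coeff e := if e.den = 1 then a e.num else 0
  bounded_denom := ⟨0, fun e he => ⟨e.num, by
    have h : e.den = 1 := by
      by_contra h
      exact he (if_neg h)
    simpa using ((Rat.den_eq_one_iff e).mp h).symm⟩⟩
  converges r hr := by
    have h1 := ha.tendsto (le_max_left 1 (max r r⁻¹))
    have h2 : Tendsto (fun n : ℤ => ‖a n‖ * r ^ n) cofinite (𝓝 0) := by
      refine squeeze_zero (fun n => by positivity) (fun n => ?_) h1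
      gcongr
      rcases Int.natAbs_eq n with h | h
      · conv_lhs => rw [h]
        rw [zpow_natCast]
        gcongr
        exact (le_max_left _ _).trans (le_max_right _ _)
      · conv_lhs => rw [h]
        rw [zpow_neg, zpow_natCast, ← inv_pow]
        gcongr
        exact (le_max_right _ _).trans (le_max_right _ _)
    rw [Metric.tendsto_nhds] at h2 ⊢
    intro ε hε
    have h3 := h2 ε hε
    rw [eventually_cofinite] at h3 ⊢
    refine (h3.image (Int.cast : ℤ → ℚ)).subset fun e he => ?_
    have he' : e.den = 1 := by
      by_contra h
      exact he (by simpa [h] using hε)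
    have he2 := (Rat.den_eq_one_iff e).mp he'
    refine ⟨e.num, fun hlt => he ?_, he2⟩
    have : r ^ (e : ℝ) = r ^ e.num := by
      rw [← Real.rpow_intCast]
      congr 1
      exact_mod_cast he2.symm
    rw [if_pos he', this]
    exact hlt

theorem coeff_ofInt_intCast (a : ℤ → K) (ha : RapidDecay a) (n : ℤ) :
    (ofInt a ha : PerfLaurent p K).coeff n = a n := by
  simp [ofInt]

/-- Only integral exponents occur. -/
def HasIntExponents (g : PerfLaurent p K) : Prop := ∀ e, g.coeff e ≠ 0 → ∃ n : ℤ, e = n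

theorem hasIntExponents_ofInt (a : ℤ → K) (ha : RapidDecay a) :
    HasIntExponents (ofInt a ha : PerfLaurent p K) := fun e he => ⟨e.num, by
  have h : e.den = 1 := by
    by_contra h
    exact he (if_neg h)
  exact ((Rat.den_eq_one_iff e).mp h).symm⟩

theorem rapidDecay_coeff (g : PerfLaurent p K) : RapidDecay fun n : ℤ => g.coeff n := by
  intro r hr
  have hr0 : 0 < r := one_pos.trans_le hr
  obtain ⟨M, hM⟩ := (g.converges r hr0).bddAbove_range_of_cofinite
  obtain ⟨M', hM'⟩ := (g.converges r⁻¹ (inv_pos.mpr hr0)).bddAbove_range_of_cofinite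
  refine ⟨max M M', fun n => ?_⟩
  have h1 := hM ⟨(n : ℚ), rfl⟩
  have h2 := hM' ⟨(n : ℚ), rfl⟩
  simp only [Rat.cast_intCast, Real.rpow_intCast] at h1 h2
  rcases Int.natAbs_eq n with h | h
  · refine le_max_of_le_left ?_
    rwa [← zpow_natCast, ← h]
  · refine le_max_of_le_right ?_
    have h3 : (n.natAbs : ℤ) = -n := by omega
    rwa [← zpow_natCast, h3, zpow_neg, ← inv_zpow]

/-- A polynomial with `P(0) ≠ 0` has an inverse power series whose coefficients grow at most
geometrically. -/
theorem exists_inverse_series [IsUltrametricDist K] {P : K[X]} (hP : P.coeff 0 ≠ 0) :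
    ∃ (l : ℤ → K) (C : ℝ), 1 ≤ C ∧ (∀ k < 0, l k = 0) ∧ (∀ k, ‖l k‖ ≤ C * C ^ k.natAbs) ∧
      ∀ k : ℤ, ∑ j ∈ Finset.range (P.natDegree + 1), P.coeff j * l (k - j) =
        if k = 0 then 1 else 0 := by
  set L : PowerSeries K := (P : PowerSeries K)⁻¹ with hL
  have hconst : PowerSeries.constantCoeff (P : PowerSeries K) = P.coeff 0 := by simp
  have hPL : (P : PowerSeries K) * L = 1 := PowerSeries.mul_inv_cancel _ (by rwa [hconst])
  set B : ℝ := ∑ j ∈ Finset.range (P.natDegree + 1), ‖P.coeff j‖ with hB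
  have hBle (j : ℕ) : ‖P.coeff j‖ ≤ B := by
    by_cases hj : j ≤ P.natDegree
    · exact Finset.single_le_sum (f := fun j => ‖P.coeff j‖) (fun _ _ => norm_nonneg _)
        (Finset.mem_range.mpr (by omega))
    · rw [Polynomial.coeff_eq_zero_of_natDegree_lt (by omega), norm_zero]
      exact Finset.sum_nonneg fun _ _ => norm_nonneg _
  have hB0 : 0 ≤ B := (norm_nonneg _).trans (hBle 0)
  -- `C` dominates `‖P.coeff 0‖⁻¹`, which starts the induction, and `‖P.coeff 0‖⁻¹ * B`, the growth
  -- per step of the recursion for the inverse series.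
  set C : ℝ := max 1 (‖P.coeff 0‖⁻¹ * max 1 B) with hC
  have hC1 : 1 ≤ C := le_max_left _ _
  have hC0 : ‖P.coeff 0‖⁻¹ ≤ C := le_max_of_le_right
    (le_mul_of_one_le_right (by positivity) (le_max_left _ _))
  have hCB : ‖P.coeff 0‖⁻¹ * B ≤ C := le_max_of_le_right
    (mul_le_mul_of_nonneg_left (le_max_right _ _) (by positivity))
  have hbound (n : ℕ) : ‖PowerSeries.coeff n L‖ ≤ C * C ^ n := by
    induction n using Nat.strong_induction_on with
    | _ n ih =>
      rw [hL, PowerSeries.coeff_inv, hconst]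
      split_ifs with hn
      · rw [hn, norm_inv, pow_zero, mul_one]
        exact hC0
      · rw [norm_mul, norm_neg, norm_inv]
        have : ‖∑ x ∈ Finset.HasAntidiagonal.antidiagonal n, if x.2 < n then
            PowerSeries.coeff x.1 (P : PowerSeries K) *
              PowerSeries.coeff x.2 (P : PowerSeries K)⁻¹ else 0‖ ≤ B * C ^ n := by
          refine IsUltrametricDist.norm_sum_le_of_forall_le_of_nonneg (by positivity) fun x _ => ?_
          split_ifs with hx
          · rw [norm_mul, Polynomial.coeff_coe]
            refine mul_le_mul (hBle _) ((ih _ hx).trans ?_) (norm_nonneg _) hB0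
            rw [← pow_succ']
            exact pow_le_pow_right₀ hC1 hx
          · rw [norm_zero]; positivity
        calc _ ≤ ‖P.coeff 0‖⁻¹ * (B * C ^ n) := by gcongr
          _ = ‖P.coeff 0‖⁻¹ * B * C ^ n := by ring
          _ ≤ C * C ^ n := by gcongr
  refine ⟨fun k => if 0 ≤ k then PowerSeries.coeff k.toNat L else 0, C, hC1,
    fun k hk => if_neg (by omega), fun k => ?_, fun k => ?_⟩
  · dsimp only
    split_ifs with hk
    · have := hbound k.toNat
      rwa [show k.toNat = k.natAbs by omega] at *
    · rw [norm_zero]; positivity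
  · rcases lt_or_ge k 0 with hk | hk
    · rw [if_neg hk.ne]
      exact Finset.sum_eq_zero fun j _ => by dsimp only; rw [if_neg (by omega), mul_zero]
    · obtain ⟨n, rfl⟩ := Int.eq_ofNat_of_zero_le hk
      have h1 := congrArg (PowerSeries.coeff n) hPL
      rw [PowerSeries.coeff_mul, PowerSeries.coeff_one,
        Finset.Nat.sum_antidiagonal_eq_sum_range_succ
          (fun i j => PowerSeries.coeff i (P : PowerSeries K) * PowerSeries.coeff j L)] at h1
      simp only [Int.natCast_eq_zero]
      rw [← h1]
      -- The sums up to the degree of `P` and up to `n` have the same nonzero terms; both are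
      -- compared with a sum over a common longer range.
      have h2 : ∀ s ≤ P.natDegree + n + 1, (∀ j, P.coeff j ≠ 0 → j ≤ n → j < s) →
          ∑ j ∈ Finset.range s, P.coeff j *
            (if (0 : ℤ) ≤ (n : ℤ) - j then PowerSeries.coeff ((n : ℤ) - j).toNat L else 0) =
          ∑ j ∈ Finset.range (P.natDegree + n + 1), P.coeff j *
            (if (0 : ℤ) ≤ (n : ℤ) - j then PowerSeries.coeff ((n : ℤ) - j).toNat L else 0) := by
        intro s hs' hs
        refine Finset.sum_subset (Finset.range_mono hs') fun j _ hj => ?_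
        by_cases hj2 : P.coeff j = 0
        · rw [hj2, zero_mul]
        · rw [if_neg, mul_zero]
          intro hj3
          exact hj (Finset.mem_range.mpr (hs j hj2 (by omega)))
      refine (h2 _ (by omega) fun j hj _ =>
        Nat.lt_succ_of_le (Polynomial.le_natDegree_of_ne_zero hj)).trans ?_
      rw [← h2 (n + 1) (by omega) fun j _ hj => Nat.lt_succ_of_le hj]
      refine Finset.sum_congr rfl fun j hj => ?_
      have := Finset.mem_range.mp hj
      rw [if_pos (by omega), Polynomial.coeff_coe]
      congr 3
      omega

end Decay

/-! ### Division by a polynomial and coprimality -/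

section Division

variable {p : ℕ} {K : Type*} [NontriviallyNormedField K] [Fact p.Prime] [IsUltrametricDist K]
  [CompleteSpace K]

theorem RapidDecay.summable_mul {a : ℤ → K} (ha : RapidDecay a) {l : ℤ → K} {C : ℝ} (hC : 1 ≤ C)
    (hl : ∀ k, ‖l k‖ ≤ C * C ^ k.natAbs) {f : ℤ → ℤ} {S : ℕ}
    (hf : ∀ n, (f n).natAbs ≤ n.natAbs + S) : Summable fun n => a n * l (f n) := by
  apply NonarchimedeanAddGroup.summable_of_tendsto_cofinite_zero
  have h1 := (ha.tendsto hC).const_mul (C * C ^ S)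
  rw [mul_zero] at h1
  refine squeeze_zero_norm (fun n => ?_) h1
  rw [norm_mul]
  calc ‖a n‖ * ‖l (f n)‖ ≤ ‖a n‖ * (C * C ^ (n.natAbs + S)) := by
        gcongr
        refine (hl _).trans ?_
        gcongr
        exact hf n
    _ = _ := by ring

/-- Division with remainder by a polynomial, for functions with integral exponents. -/
theorem exists_eq_mul_add {P : K[X]} (hP : P.coeff 0 ≠ 0) {g : PerfLaurent p K}
    (hg : HasIntExponents g) : ∃ (Q : PerfLaurent p K) (S : K[X]), HasIntExponents Q ∧
      g = ofPolynomial P * Q + ofPolynomial S := by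
  have hP0 : P ≠ 0 := by rintro rfl; simp at hP
  set d := P.natDegree with hd
  have hrd : P.reverse.natDegree = d := by
    rw [Polynomial.reverse_natDegree, Polynomial.natTrailingDegree_eq_zero_of_constantCoeff_ne_zero
      (by simpa using hP), Nat.sub_zero]
  obtain ⟨l, C, hC, hl0, hl, hlsum⟩ := exists_inverse_series hP
  obtain ⟨h, C', hC', hh0, hh, hhsum⟩ := exists_inverse_series (P := P.reverse) (by
    rw [Polynomial.coeff_zero_reverse]
    exact leadingCoeff_ne_zero.mpr hP0)
  set a : ℤ → K := fun n => g.coeff n with ha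
  have hadec : RapidDecay a := rapidDecay_coeff g
  have hsum1 (s : ℤ) : Summable fun n => a n * l (s - n) :=
    hadec.summable_mul hC hl (S := s.natAbs) fun n => by omega
  have hsum2 (s : ℤ) : Summable fun n => a n * h (n - s) :=
    hadec.summable_mul hC' hh (S := s.natAbs) fun n => by omega
  -- The quotient `g / P` is expanded in two ways: the coefficients with `m ≥ 0` use `1 / P` as a
  -- series in `X⁻¹`, those with `m < 0` use it as a series in `X`. As `h` and `l` vanish at
  -- negative arguments, only coefficients `a n` at least as far out as `m` contribute.
  set b : ℤ → K := fun m => if 0 ≤ m then ∑' n, a n * h (n - (d + m)) else ∑' n, a n * l (m - n)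
    with hb
  have hbdec : RapidDecay b := by
    refine RapidDecay.of_ge (max C C') fun r hr1 hr => ?_
    obtain ⟨M, hM⟩ := hadec r hr1
    have hM0 : 0 ≤ M := le_trans (by positivity) (hM 0)
    have hrC : C ≤ r := (le_max_left _ _).trans hr
    have hrC' : C' ≤ r := (le_max_right _ _).trans hr
    -- In each nonzero term the growth of `c` and the factor `r ^ |m|` are together absorbed by `r ^
    -- |n|`.
    have key (c : ℤ → K) (D : ℝ) (hD1 : 1 ≤ D) (hDr : D ≤ r) (hDm : D ≤ max C C')
        (hc0 : ∀ k < 0, c k = 0) (hc : ∀ k, ‖c k‖ ≤ D * D ^ k.natAbs) (f : ℤ → ℤ) (m : ℤ)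
        (hf : ∀ n, 0 ≤ f n → (f n).natAbs + m.natAbs ≤ n.natAbs) :
        ‖∑' n, a n * c (f n)‖ * r ^ m.natAbs ≤ max C C' * M := by
      rw [← le_div_iff₀ (by positivity)]
      refine norm_tsum_le_of_forall_ultra (by positivity) fun n => ?_
      rcases lt_or_ge (f n) 0 with hfn | hfn
      · rw [hc0 _ hfn, mul_zero, norm_zero]
        positivity
      · rw [le_div_iff₀ (by positivity), norm_mul]
        calc ‖a n‖ * ‖c (f n)‖ * r ^ m.natAbs
            ≤ ‖a n‖ * (D * D ^ (f n).natAbs) * r ^ m.natAbs := by gcongr; exact hc _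
          _ ≤ ‖a n‖ * (D * r ^ (f n).natAbs) * r ^ m.natAbs := by gcongr
          _ = D * (‖a n‖ * r ^ ((f n).natAbs + m.natAbs)) := by rw [pow_add]; ring
          _ ≤ D * (‖a n‖ * r ^ n.natAbs) := by gcongr; exact hf n hfn
          _ ≤ max C C' * M := by gcongr; exact hM n
    refine ⟨max C C' * M, fun m => ?_⟩
    rw [hb]
    dsimp only
    split_ifs with hm
    · exact key h C' hC' hrC' (le_max_right _ _) hh0 hh _ m fun n hn => by omega
    · exact key l C hC hrC (le_max_left _ _) hl0 hl _ m fun n hn => by omega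
  have hprod (m : ℤ) : (ofPolynomial P * ofInt b hbdec : PerfLaurent p K).coeff m =
      ∑ j ∈ Finset.range (d + 1), P.coeff j * b (m - j) := by
    rw [coeff_ofPolynomial_mul]
    refine Finset.sum_congr rfl fun j _ => ?_
    rw [← coeff_ofInt_intCast (p := p) b hbdec]
    push_cast
    rfl
  have hconv (c : ℤ → K) (f : ℕ → ℤ → ℤ) (m : ℤ) (hs : ∀ j, Summable fun n => a n * c (f j n))
      (hc : ∀ n, ∑ j ∈ Finset.range (d + 1), P.coeff j * c (f j n) = if n = m then 1 else 0) :
      ∑ j ∈ Finset.range (d + 1), P.coeff j * ∑' n, a n * c (f j n) = a m := by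
    simp_rw [← tsum_mul_left]
    rw [← Summable.tsum_finsetSum fun j _ => (hs j).mul_left _]
    have (n : ℤ) : ∑ j ∈ Finset.range (d + 1), P.coeff j * (a n * c (f j n)) =
        if n = m then a n else 0 := by
      calc _ = a n * ∑ j ∈ Finset.range (d + 1), P.coeff j * c (f j n) := by
            rw [Finset.mul_sum]
            exact Finset.sum_congr rfl fun j _ => by ring
        _ = _ := by rw [hc]; simp
    simp_rw [this]
    rw [tsum_ite_eq]
  -- For `m < 0` every index `m - j` is negative, and for `m ≥ d` every one is nonnegative. In both
  -- ranges a single expansion of `1 / P` enters and the product returns `g`, so the remainder lives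
  -- in degrees `0` to `d - 1`.
  have hlow (m : ℤ) (hm : m < 0) :
      (ofPolynomial P * ofInt b hbdec : PerfLaurent p K).coeff m = g.coeff m := by
    rw [hprod]
    refine Eq.trans (Finset.sum_congr rfl fun j _ => ?_)
      (hconv l (fun j n => m - j - n) m (fun j => hsum1 _) fun n => ?_)
    · rw [hb]
      dsimp only
      rw [if_neg (by omega)]
    · have := hlsum (m - n)
      simp only [sub_right_comm m n, sub_eq_zero, eq_comm (a := m)] at this
      exact this
  have hhigh (m : ℤ) (hm : d ≤ m) :
      (ofPolynomial P * ofInt b hbdec : PerfLaurent p K).coeff m = g.coeff m := by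
    rw [hprod]
    refine Eq.trans (Finset.sum_congr rfl fun j hj => ?_)
      (hconv h (fun j n => n - (d + (m - j))) m (fun j => hsum2 _) fun n => ?_)
    · have := Finset.mem_range.mp hj
      rw [hb]
      dsimp only
      rw [if_pos (by omega)]
    · have := hhsum (n - m)
      rw [hrd, ← Finset.sum_range_reflect] at this
      simp only [sub_eq_zero] at this
      rw [← this]
      refine Finset.sum_congr rfl fun j hj => ?_
      have := Finset.mem_range.mp hj
      rw [Polynomial.coeff_reverse, Polynomial.revAt_le (by omega)]
      congr 2 <;> omega
  refine ⟨ofInt b hbdec, ∑ m ∈ Finset.range d, monomial m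
    ((g - ofPolynomial P * ofInt b hbdec).coeff m), hasIntExponents_ofInt _ _, ?_⟩
  rw [← sub_eq_iff_eq_add']
  set R := g - ofPolynomial P * ofInt b hbdec with hR
  have hRc (m : ℤ) : R.coeff m = g.coeff m - (ofPolynomial P * ofInt b hbdec : PerfLaurent p K).coeff m := by
    rw [hR, sub_eq_add_neg, coeff_add, coeff_neg, sub_eq_add_neg]
  ext e
  by_cases he : ∃ n : ℕ, e = n
  · obtain ⟨n, rfl⟩ := he
    rw [coeff_ofPolynomial_natCast, Polynomial.finsetSum_coeff]
    simp only [Polynomial.coeff_monomial, Finset.sum_ite_eq', Finset.mem_range]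
    split_ifs with hn
    · rfl
    · have := hRc n
      rw [hhigh n (by omega), sub_self] at this
      exact_mod_cast this
  · have h0 : (ofPolynomial (∑ m ∈ Finset.range d, monomial m (R.coeff m)) :
        PerfLaurent p K).coeff e = 0 := by
      by_contra h
      exact he (exists_natCast_of_coeff_ofPolynomial_ne_zero h)
    rw [h0]
    by_cases he' : ∃ n : ℤ, e = n
    · obtain ⟨n, rfl⟩ := he'
      have hn : n < 0 := by
        by_contra hn
        exact he ⟨n.toNat, by
          have : ((n.toNat : ℤ) : ℚ) = n := by rw [Int.toNat_of_nonneg (by omega)]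
          exact_mod_cast this.symm⟩
      rw [hRc, hlow n hn, sub_self]
    · have hg0 : g.coeff e = 0 := by
        by_contra h
        exact he' (hg e h)
      rw [hR, sub_eq_add_neg, coeff_add, coeff_neg, hg0, zero_add, neg_eq_zero,
        coeff_ofPolynomial_mul]
      refine Finset.sum_eq_zero fun j _ => ?_
      have : (ofInt b hbdec : PerfLaurent p K).coeff (e - j) = 0 := by
        by_contra h
        obtain ⟨n, hn⟩ := hasIntExponents_ofInt _ _ _ h
        exact he' ⟨n + j, by push_cast; linarith⟩
      rw [this, mul_zero]

theorem hasIntExponents_ofPolynomial (P : K[X]) :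
    HasIntExponents (ofPolynomial P : PerfLaurent p K) := fun _ he => by
  obtain ⟨n, rfl⟩ := exists_natCast_of_coeff_ofPolynomial_ne_zero he
  exact ⟨n, by simp⟩

theorem HasIntExponents.add {g h : PerfLaurent p K} (hg : HasIntExponents g)
    (hh : HasIntExponents h) : HasIntExponents (g + h) := fun e he => by
  by_cases h0 : g.coeff e = 0
  · exact hh e (by simpa [h0] using he)
  · exact hg e h0

/-- An irreducible polynomial divides a function with integral exponents or is coprime to it. -/
theorem HasIntExponents.dvd_or_isCoprime {P : K[X]} (hP : P.coeff 0 ≠ 0) (hirr : Irreducible P)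
    {g : PerfLaurent p K} (hg : HasIntExponents g) :
    (∃ Q, HasIntExponents Q ∧ g = ofPolynomial P * Q) ∨ IsCoprime (ofPolynomial P) g := by
  obtain ⟨Q, S, hQ, rfl⟩ := exists_eq_mul_add hP hg
  rcases _root_.dvd_or_isCoprime _ S hirr with ⟨T, rfl⟩ | h
  · exact Or.inl ⟨Q + ofPolynomial T, hQ.add (hasIntExponents_ofPolynomial T), by
      rw [ofPolynomial_mul, mul_add]⟩
  · exact Or.inr ((isCoprime_ofPolynomial h).mul_add_left_right Q)

/-- As long as the cofactor is not coprime to `P`, another `P` can be split off; the bound on the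
multiplicity stops this. -/
theorem HasIntExponents.exists_eq_pow_mul {P : K[X]} (hP : P.coeff 0 ≠ 0) (hirr : Irreducible P)
    {g : PerfLaurent p K} (hg : HasIntExponents g) (hg0 : g ≠ 0) :
    ∃ (n : ℕ) (g' : PerfLaurent p K), g = ofPolynomial P ^ n * g' ∧
      IsCoprime (ofPolynomial P) g' := by
  by_contra! H
  have h1 (n : ℕ) : ∃ g', HasIntExponents g' ∧ g = ofPolynomial P ^ n * g' := by
    induction n with
    | zero => exact ⟨g, hg, by simp⟩
    | succ n ih =>
      obtain ⟨g', hg', rfl⟩ := ih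
      rcases hg'.dvd_or_isCoprime hP hirr with ⟨Q, hQ, rfl⟩ | h
      · exact ⟨Q, hQ, by ring⟩
      · exact absurd h (H n g' rfl)
  obtain ⟨N, hN⟩ := exists_not_pow_dvd hP hirr.natDegree_pos.ne' hg0
  obtain ⟨g', -, h2⟩ := h1 (N + 1)
  exact absurd (hN _ ⟨g', h2⟩) (by omega)

end Division

end PerfLaurent

/-! ### Infinite `q`-products -/

/-- The coefficients of the entire function `∏ u(q ^ n X)`, `n ≥ 0`, where `u(0) = 1`. -/
noncomputable def qProductCoeff {K : Type*} [Field K] (u : Polynomial K) (q : K) : ℕ → K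
  | 0 => 1
  | m + 1 => (1 - q ^ (m + 1))⁻¹ *
      ∑ j : Fin (m + 1), u.coeff (m + 1 - j) * q ^ (j : ℕ) * qProductCoeff u q j
  decreasing_by exact j.2

section QProduct

variable {K : Type*} [NontriviallyNormedField K]

theorem norm_one_sub_pow [IsUltrametricDist K] {q : K} (hq : ‖q‖ < 1) (m : ℕ) :
    ‖1 - q ^ (m + 1)‖ = 1 := by
  have h : ‖-q ^ (m + 1)‖ < 1 := by
    rw [norm_neg, norm_pow]
    exact pow_lt_one₀ (norm_nonneg _) hq (by omega)
  rw [sub_eq_add_neg, IsUltrametricDist.norm_add_eq_max_of_norm_ne_norm (by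
    rw [norm_one]; exact h.ne'), norm_one, max_eq_left h.le]

variable [IsUltrametricDist K]

/-- This is `E(X) = u(X) E(qX)` in degree `m`. The recursive definition solves it for the top
coefficient, which is possible because `1 - q ^ m` has norm one for `m > 0`. -/
theorem qProductCoeff_eq_sum {u : K[X]} (hu : u.coeff 0 = 1) {q : K} (hq : ‖q‖ < 1) (m : ℕ) :
    qProductCoeff u q m =
      ∑ j ∈ Finset.range (m + 1), u.coeff (m - j) * (qProductCoeff u q j * q ^ j) := by
  cases m with
  | zero => simp [hu]
  | succ m =>
    rw [Finset.sum_range_succ, Nat.sub_self, hu, one_mul]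
    have h0 : 1 - q ^ (m + 1) ≠ 0 := norm_ne_zero_iff.mp (by rw [norm_one_sub_pow hq]; norm_num)
    have h1 : (1 - q ^ (m + 1)) * qProductCoeff u q (m + 1) =
        ∑ j ∈ Finset.range (m + 1), u.coeff (m + 1 - j) * (qProductCoeff u q j * q ^ j) := by
      rw [qProductCoeff, mul_inv_cancel_left₀ h0, ← Fin.sum_univ_eq_sum_range
        (fun j => u.coeff (m + 1 - j) * (qProductCoeff u q j * q ^ j))]
      exact Finset.sum_congr rfl fun j _ => by ring
    rw [← h1]
    ring

theorem qProductCoeff_bounded {u : K[X]} {q : K} (hq : ‖q‖ < 1) {r : ℝ} (hr : 1 ≤ r) :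
    ∃ M : ℝ, ∀ n, ‖qProductCoeff u q n‖ * r ^ n ≤ M := by
  set d := u.natDegree
  set B : ℝ := ∑ j ∈ Finset.range (d + 1), ‖u.coeff j‖ with hB
  have hBle (j : ℕ) (hj : j ≤ d) : ‖u.coeff j‖ ≤ B :=
    Finset.single_le_sum (f := fun j => ‖u.coeff j‖) (fun _ _ => norm_nonneg _)
      (Finset.mem_range.mpr (by omega))
  have hB0 : 0 ≤ B := (norm_nonneg _).trans (hBle 0 (by omega))
  -- From degree `N + d + 1` on, the recursion only involves indices `j ≥ N`, where `‖q‖ ^ j`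
  -- outweighs `B * r ^ d`. So the maximum is controlled by the initial terms.
  obtain ⟨N, hN⟩ : ∃ N : ℕ, B * r ^ d * ‖q‖ ^ N ≤ 1 := by
    have h := (tendsto_pow_atTop_nhds_zero_of_lt_one (norm_nonneg q) hq).const_mul (B * r ^ d)
    rw [mul_zero] at h
    obtain ⟨N, hN⟩ := (h.eventually (gt_mem_nhds one_pos)).exists
    exact ⟨N, hN.le⟩
  set M : ℝ := ∑ n ∈ Finset.range (N + d + 1), ‖qProductCoeff u q n‖ * r ^ n with hM
  have hM0 : 0 ≤ M := Finset.sum_nonneg fun n _ => by positivity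
  refine ⟨M, fun n => ?_⟩
  induction n using Nat.strong_induction_on with
  | _ n ih =>
    by_cases hn : n < N + d + 1
    · exact Finset.single_le_sum (f := fun n => ‖qProductCoeff u q n‖ * r ^ n)
        (fun n _ => by positivity) (Finset.mem_range.mpr hn)
    rcases n with _ | m
    · omega
    · rw [qProductCoeff, norm_mul, norm_inv, norm_one_sub_pow hq, inv_one, one_mul,
        ← le_div_iff₀ (by positivity)]
      refine IsUltrametricDist.norm_sum_le_of_forall_le_of_nonneg (by positivity) fun j _ => ?_
      rw [le_div_iff₀ (by positivity), norm_mul, norm_mul, norm_pow]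
      by_cases hj : m + 1 - (j : ℕ) ≤ d
      · have hjN : N ≤ (j : ℕ) := by omega
        calc ‖u.coeff (m + 1 - j)‖ * ‖q‖ ^ (j : ℕ) * ‖qProductCoeff u q j‖ * r ^ (m + 1)
            = ‖u.coeff (m + 1 - j)‖ * r ^ (m + 1 - (j : ℕ)) * ‖q‖ ^ (j : ℕ) *
                (‖qProductCoeff u q j‖ * r ^ (j : ℕ)) := by
              rw [← pow_sub_mul_pow r (by omega : (j : ℕ) ≤ m + 1)]
              ring
          _ ≤ B * r ^ d * ‖q‖ ^ N * M := by
              gcongr ?_ * ?_ * ?_ * ?_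
              · exact hBle _ hj
              · exact pow_le_pow_right₀ hr hj
              · exact pow_le_pow_of_le_one (norm_nonneg _) hq.le hjN
              · exact ih _ j.2
          _ ≤ M := by
              conv_rhs => rw [← one_mul M]
              gcongr
      · rw [Polynomial.coeff_eq_zero_of_natDegree_lt (by omega)]
        simpa using hM0

end QProduct

/-- Splits an infinite product into finitely many factors and a tail; it starts at index `1` because
the factor `y 0` is the polynomial itself. -/
theorem IsCoprime.of_eq_mul_succ {R : Type*} [CommSemiring R] {a : R} {x y : ℕ → R}
    (hxy : ∀ n, x n = y n * x (n + 1)) (hy : ∀ n, 1 ≤ n → IsCoprime a (y n)) {N : ℕ} (hN : 1 ≤ N)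
    (hx : IsCoprime a (x N)) : IsCoprime a (x 1) := by
  induction N, hN using Nat.le_induction with
  | base => exact hx
  | succ n hn ih => exact ih (by rw [hxy]; exact (hy n hn).mul_right hx)

/-! ### Theta functions -/

namespace PerfLaurent

variable {p : ℕ} {K : Type*} [NontriviallyNormedField K] [Fact p.Prime] [IsUltrametricDist K]
  [CompleteSpace K]

theorem coeff_shiftHom_inv_iterate (q : RootSystem p K) (g : PerfLaurent p K) (N : ℕ) (n : ℤ) :
    ((shiftHom q.inv)^[N] g).coeff n = g.coeff n * (q.seq 0 ^ n) ^ N := by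
  rw [coeff_shiftHom_iterate, q.expo_inv, inv_inv, q.expo_intCast]

/-- The entire function `E = ∏ u(q ^ n X)`, `n ≥ 0`, characterized by `E(X) = u(X) E(qX)`. -/
theorem exists_qProduct (q : RootSystem p K) (hq : ‖q.seq 0‖ < 1) {u : K[X]}
    (hu : u.coeff 0 = 1) : ∃ E : PerfLaurent p K, E.coeff 0 = 1 ∧
      (∀ e, E.coeff e ≠ 0 → ∃ n : ℕ, e = n) ∧ E = ofPolynomial u * shiftHom q.inv E := by
  set c := qProductCoeff u (q.seq 0) with hc
  set a : ℤ → K := fun n => if 0 ≤ n then c n.toNat else 0 with ha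
  have hdec : RapidDecay a := fun r hr => by
    obtain ⟨M, hM⟩ := qProductCoeff_bounded (u := u) hq hr
    refine ⟨M, fun n => ?_⟩
    rw [ha]
    dsimp only
    split_ifs with hn
    · rw [show n.natAbs = n.toNat by omega]
      exact hM _
    · rw [norm_zero, zero_mul]
      exact le_trans (by positivity) (hM 0)
  set E : PerfLaurent p K := ofInt a hdec with hE
  have hEZ (n : ℤ) : E.coeff n = a n := coeff_ofInt_intCast a hdec n
  have hEint : HasIntExponents E := hasIntExponents_ofInt a hdec
  have hsupp (e : ℚ) (he : E.coeff e ≠ 0) : ∃ n : ℕ, e = n := by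
    obtain ⟨n, rfl⟩ := hEint e he
    rw [hEZ] at he
    have hn : 0 ≤ n := by
      by_contra hn
      exact he (if_neg hn)
    obtain ⟨n, rfl⟩ := Int.eq_ofNat_of_zero_le hn
    exact ⟨n, by simp⟩
  have hE0 : E.coeff 0 = 1 := by
    have := hEZ 0
    rw [Int.cast_zero] at this
    rw [this, ha]
    simp [hc, qProductCoeff]
  refine ⟨E, hE0, hsupp, ?_⟩
  ext e
  rw [coeff_ofPolynomial_mul]
  by_cases he : ∃ n : ℤ, e = n
  · obtain ⟨n, rfl⟩ := he
    have h1 (j : ℕ) : (shiftHom q.inv E).coeff ((n : ℚ) - j) = a (n - j) * q.seq 0 ^ (n - j) := by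
      rw [← hEZ, show (n : ℚ) - j = ((n - j : ℤ) : ℚ) by push_cast; rfl, coeff_shiftHom, q.expo_inv,
        inv_inv, q.expo_intCast]
    simp_rw [h1]
    rw [hEZ]
    rcases lt_or_ge n 0 with hn | hn
    · rw [ha]
      dsimp only
      rw [if_neg (by omega)]
      exact (Finset.sum_eq_zero fun j _ => by rw [if_neg (by omega), zero_mul, mul_zero]).symm
    · obtain ⟨n, rfl⟩ := Int.eq_ofNat_of_zero_le hn
      have h2 : ∀ s ≤ u.natDegree + n + 1, (∀ j, u.coeff j ≠ 0 → j ≤ n → j < s) →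
          ∑ j ∈ Finset.range s, u.coeff j * (a (n - j) * q.seq 0 ^ ((n : ℤ) - j)) =
          ∑ j ∈ Finset.range (u.natDegree + n + 1),
            u.coeff j * (a (n - j) * q.seq 0 ^ ((n : ℤ) - j)) := by
        intro s hs' hs
        refine Finset.sum_subset (Finset.range_mono hs') fun j _ hj => ?_
        by_cases hj2 : u.coeff j = 0
        · rw [hj2, zero_mul]
        · have : a (n - j) = 0 := if_neg fun hj3 => hj (Finset.mem_range.mpr (hs j hj2 (by omega)))
          rw [this, zero_mul, mul_zero]
      rw [h2 _ (by omega) fun j hj _ =>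
        Nat.lt_succ_of_le (Polynomial.le_natDegree_of_ne_zero hj),
        ← h2 (n + 1) (by omega) fun j _ hj => Nat.lt_succ_of_le hj]
      have h3 : a n = c n := by simp [ha]
      rw [h3, hc, qProductCoeff_eq_sum hu hq, ← Finset.sum_range_reflect]
      refine Finset.sum_congr rfl fun j hj => ?_
      have := Finset.mem_range.mp hj
      have h4 : (n : ℤ) - j = ((n + 1 - 1 - j : ℕ) : ℤ) := by omega
      rw [h4, zpow_natCast, show n - (n + 1 - 1 - j) = j by omega]
      simp [ha, hc]
  · have h0 : E.coeff e = 0 := by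
      by_contra h
      exact he (hEint e h)
    rw [h0]
    refine (Finset.sum_eq_zero fun j _ => ?_).symm
    have : E.coeff (e - j) = 0 := by
      by_contra h
      obtain ⟨n, hn⟩ := hEint _ h
      exact he ⟨n + j, by push_cast; linarith⟩
    rw [coeff_shiftHom, this, zero_mul, mul_zero]

theorem HasIntExponents.shiftHom_iterate (q : RootSystem p K) {g : PerfLaurent p K}
    (hg : HasIntExponents g) (N : ℕ) : HasIntExponents ((shiftHom q)^[N] g) := fun e he => by
  rw [coeff_shiftHom_iterate] at he
  exact hg e (left_ne_zero_of_mul he)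

theorem HasIntExponents.reflect {g : PerfLaurent p K} (hg : HasIntExponents g) :
    HasIntExponents (reflect g) := fun e he => by
  obtain ⟨n, hn⟩ := hg _ he
  exact ⟨-n, by push_cast; linarith⟩

/-- `E(q ^ N X)` is close to its constant term on bounded sets. -/
theorem exists_shiftHom_iterate_termNorm_lt (q : RootSystem p K) (hq : ‖q.seq 0‖ < 1)
    {E : PerfLaurent p K} (hE : ∀ e, E.coeff e ≠ 0 → ∃ n : ℕ, e = n) {s : ℝ} (hs : 0 < s) :
    ∃ N, 1 ≤ N ∧ ∀ e ≠ 0, termNorm s ((shiftHom q.inv)^[N] E) e < 1 := by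
  obtain ⟨M, hM⟩ := (E.converges s hs).bddAbove_range_of_cofinite
  obtain ⟨N, hN, hN1⟩ : ∃ N : ℕ, M * ‖q.seq 0‖ ^ N < 1 ∧ 1 ≤ N := by
    have h := (tendsto_pow_atTop_nhds_zero_of_lt_one (norm_nonneg _) hq).const_mul M
    rw [mul_zero] at h
    exact ((h.eventually (gt_mem_nhds one_pos)).and (eventually_ge_atTop 1)).exists
  refine ⟨N, hN1, fun e he => ?_⟩
  by_cases h0 : E.coeff e = 0
  · rw [termNorm, coeff_shiftHom_iterate, h0]
    simp
  · obtain ⟨n, rfl⟩ := hE e h0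
    have hn : n ≠ 0 := by rintro rfl; simp at he
    have h1 := coeff_shiftHom_inv_iterate q E N n
    rw [Int.cast_natCast] at h1
    have h2 : ‖E.coeff n‖ * s ^ ((n : ℚ) : ℝ) ≤ M := hM ⟨(n : ℚ), rfl⟩
    rw [termNorm, h1, norm_mul, norm_pow, zpow_natCast, norm_pow]
    calc ‖E.coeff n‖ * (‖q.seq 0‖ ^ n) ^ N * s ^ ((n : ℚ) : ℝ)
        = (‖E.coeff n‖ * s ^ ((n : ℚ) : ℝ)) * (‖q.seq 0‖ ^ n) ^ N := by ring
      _ ≤ M * ‖q.seq 0‖ ^ N := by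
          refine mul_le_mul h2 ?_ (by positivity) (le_trans (by positivity) h2)
          exact pow_le_pow_left₀ (by positivity) (pow_le_of_le_one (norm_nonneg _) hq.le hn) N
      _ < 1 := hN

/-- For large `N` the functions `E(q ^ N X)` and `E(q ^ N X⁻¹)` are close to `1` on the annulus
containing the roots of `P`, so `P` does not divide them. As their exponents are integral and `P` is
irreducible, coprimality follows. -/
theorem exists_isCoprime_shiftHom_iterate (q : RootSystem p K) (hq : ‖q.seq 0‖ < 1)
    {E : PerfLaurent p K} (hE0 : E.coeff 0 = 1) (hE : ∀ e, E.coeff e ≠ 0 → ∃ n : ℕ, e = n)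
    {P : K[X]} (hP : P.coeff 0 ≠ 0) (hirr : Irreducible P) :
    (∃ N, 1 ≤ N ∧ IsCoprime (ofPolynomial P) ((shiftHom q.inv)^[N] E)) ∧
      ∃ N, 1 ≤ N ∧ IsCoprime (ofPolynomial P) (reflect ((shiftHom q.inv)^[N] E)) := by
  obtain ⟨r, R, hr, hrR, hbot, htop⟩ := exists_isDominant_ofPolynomial (p := p) hP
  have hR := hr.trans_le hrR
  have hint : HasIntExponents E := fun e he => by
    obtain ⟨n, rfl⟩ := hE e he
    exact ⟨n, by simp⟩
  have h0 (N : ℕ) : ((shiftHom q.inv)^[N] E).coeff 0 = 1 := by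
    have := coeff_shiftHom_inv_iterate q E N 0
    simpa [hE0] using this
  -- Only exponents `≥ 0` occur, so the estimate on the larger of two circles suffices: `R` for the
  -- product in `X`, `r⁻¹` for the product in `X⁻¹`.
  have hmono {s t : ℝ} (hs : 0 < s) (hst : s ≤ t) (N : ℕ) (e : ℚ) :
      termNorm s ((shiftHom q.inv)^[N] E) e ≤ termNorm t ((shiftHom q.inv)^[N] E) e := by
    rw [termNorm, termNorm, coeff_shiftHom_iterate]
    by_cases h0 : E.coeff e = 0
    · simp [h0]
    · obtain ⟨n, rfl⟩ := hE e h0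
      gcongr
  have hrefl (s : ℝ) (hs : 0 < s) (g : PerfLaurent p K) (e : ℚ) :
      termNorm s (reflect g) e = termNorm s⁻¹ g (-e) := by
    rw [termNorm, termNorm, coeff_reflect]
    simp [Real.inv_rpow hs.le, Real.rpow_neg hs.le]
  constructor
  · obtain ⟨N, hN1, hN⟩ := exists_shiftHom_iterate_termNorm_lt q hq hE hR
    refine ⟨N, hN1, ((hint.shiftHom_iterate q.inv N).dvd_or_isCoprime hP hirr).resolve_left ?_⟩
    rintro ⟨Q, -, hQ⟩
    exact not_ofPolynomial_dvd hirr.natDegree_pos.ne' hr hrR hbot htop (h0 N)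
      (fun e he => (hmono hr hrR N e).trans_lt (hN e he)) hN ⟨Q, hQ⟩
  · obtain ⟨N, hN1, hN⟩ := exists_shiftHom_iterate_termNorm_lt q hq hE (inv_pos.mpr hr)
    refine ⟨N, hN1, ((hint.shiftHom_iterate q.inv N).reflect.dvd_or_isCoprime hP hirr).resolve_left ?_⟩
    rintro ⟨Q, -, hQ⟩
    refine not_ofPolynomial_dvd hirr.natDegree_pos.ne' hr hrR hbot htop
      (by rw [coeff_reflect, neg_zero, h0]) (fun e he => ?_) (fun e he => ?_) ⟨Q, hQ⟩
    · rw [hrefl r hr]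
      exact hN _ (neg_ne_zero.mpr he)
    · rw [hrefl R hR]
      exact (hmono (inv_pos.mpr hR) (inv_anti₀ hr hrR) N _).trans_lt (hN _ (neg_ne_zero.mpr he))

theorem reflect_single (n : ℤ) (c : K) : reflect (single n c : PerfLaurent p K) = single (-n) c := by
  ext e
  rw [coeff_reflect, coeff_single, coeff_single]
  congr 1
  push_cast
  exact propext ⟨fun h => by linarith, fun h => by linarith⟩

theorem ofPolynomial_C_mul (c : K) (P : K[X]) :
    (ofPolynomial (C c * P) : PerfLaurent p K) = single 0 c * ofPolynomial P := by
  rw [ofPolynomial_eq_aeval, map_mul, aeval_C, algebraMap_eq, ofPolynomial_eq_aeval]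

theorem isUnit_shiftHom_iterate (q : RootSystem p K) {g : PerfLaurent p K} (hg : IsUnit g)
    (n : ℕ) : IsUnit ((shiftHom q)^[n] g) := by
  induction n with
  | zero => exact hg
  | succ n ih => rw [Function.iterate_succ_apply']; exact ih.map _

/-- The theta function `∏ P(q ^ n X)`, `n ≠ 0`, with suitable convergence factors. -/
theorem exists_theta (q : RootSystem p K) (hq : ‖q.seq 0‖ < 1) {P : K[X]} (hP : P.coeff 0 ≠ 0) :
    ∃ Θ : PerfLaurent p K, Θ ≠ 0 ∧
      shiftHom q (ofPolynomial P * Θ) = single P.natDegree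
        (P.leadingCoeff / P.coeff 0 / q.seq 0 ^ P.natDegree) * (ofPolynomial P * Θ) ∧
      ∀ Q : K[X], Irreducible Q → Q.coeff 0 ≠ 0 →
        (∀ n : ℤ, n ≠ 0 → IsCoprime Q (P.comp (C (q.seq 0 ^ n) * X))) →
        IsCoprime (ofPolynomial Q) Θ := by
  have hP0 : P ≠ 0 := by rintro rfl; simp at hP
  have hl : P.leadingCoeff ≠ 0 := leadingCoeff_ne_zero.mpr hP0
  have hq0 := q.ne_zero
  obtain ⟨E, hE0, hEs, hE⟩ := exists_qProduct q hq (u := C (P.coeff 0)⁻¹ * P) (by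
    rw [Polynomial.coeff_C_mul, inv_mul_cancel₀ hP])
  obtain ⟨W, hW0, hWs, hW⟩ := exists_qProduct q hq (u := C P.leadingCoeff⁻¹ * P.reverse) (by
    rw [Polynomial.coeff_C_mul, Polynomial.coeff_zero_reverse, inv_mul_cancel₀ hl])
  set τ := shiftHom q.inv with hτ
  have hrefl : reflect (ofPolynomial (C P.leadingCoeff⁻¹ * P.reverse) : PerfLaurent p K) =
      single (-P.natDegree) P.leadingCoeff⁻¹ * ofPolynomial P := by
    rw [ofPolynomial_C_mul, map_mul, reflect_single, reflect_reverse, ← mul_assoc,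
      single_mul_single]
    simp
  have hiter (u F : PerfLaurent p K) (hF : F = u * τ F) (n : ℕ) :
      τ^[n] F = τ^[n] u * τ^[n + 1] F := by
    conv_lhs => rw [hF]
    rw [iterate_map_mul, Function.iterate_succ_apply]
  have hne (F : PerfLaurent p K) (hF : F.coeff 0 = 1) (n : ℕ) : (τ^[n] F).coeff 0 = 1 := by
    have := coeff_shiftHom_inv_iterate q F n 0
    simpa [hF] using this
  have hne' (F : PerfLaurent p K) (hF : F.coeff 0 = 1) : F ≠ 0 := by
    rintro rfl
    simp at hF
  -- `τ` is `X ↦ qX`. Thus `τ E` collects the factors with `n ≥ 1`, and `reflect (τ W)`, which is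
  -- `W(q X⁻¹)`, those with `n ≤ -1`; the factor with `n = 0` is left out.
  refine ⟨τ E * reflect (τ W), ?_, ?_, ?_⟩
  · refine mul_ne_zero (hne' _ (hne E hE0 1)) (hne' _ ?_)
    rw [coeff_reflect, neg_zero]
    exact hne W hW0 1
  · have h1 : shiftHom q (reflect (ofPolynomial (C P.leadingCoeff⁻¹ * P.reverse))) *
        shiftHom q (reflect (τ W)) = reflect (τ W) := by
      rw [← map_mul, ← map_mul, shiftHom_reflect, map_mul, ← hτ]
      exact congrArg reflect (by
        conv_rhs => rw [hW]
        rw [map_mul])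
    rw [hrefl, map_mul, shiftHom_single] at h1
    have h2 : shiftHom q (τ E) = single 0 (P.coeff 0)⁻¹ * ofPolynomial P * τ E := by
      rw [shiftHom_shiftHom_inv, ← ofPolynomial_C_mul]
      exact hE
    -- The inverse of the monomial by which the shifted reflected factor differs from the shifted
    -- `P`; together with `P(0)⁻¹` from `E` it forms the multiplier.
    have h3 : (single P.natDegree (P.leadingCoeff / q.seq 0 ^ P.natDegree) : PerfLaurent p K) *
        single (-P.natDegree) (P.leadingCoeff⁻¹ * (q.seq 0 ^ (-P.natDegree : ℤ))⁻¹) = 1 := by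
      rw [single_mul_single, add_neg_cancel, ← single_zero_one]
      congr 1
      rw [zpow_neg, inv_inv, zpow_natCast]
      field_simp
    have h4 : (single P.natDegree (P.leadingCoeff / P.coeff 0 / q.seq 0 ^ P.natDegree) :
        PerfLaurent p K) = single P.natDegree (P.leadingCoeff / q.seq 0 ^ P.natDegree) *
          single 0 (P.coeff 0)⁻¹ := by
      rw [single_mul_single, add_zero]
      congr 1
      ring
    rw [map_mul, map_mul, h2, h4]
    linear_combination (single P.natDegree (P.leadingCoeff / q.seq 0 ^ P.natDegree) *
      single 0 (P.coeff 0)⁻¹ * ofPolynomial P * τ E) * h1 - (shiftHom q (ofPolynomial P) *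
      single 0 (P.coeff 0)⁻¹ * ofPolynomial P * τ E * shiftHom q (reflect (τ W))) * h3
  · intro Q hirr hQ hcop
    obtain ⟨N, hN1, hN⟩ := (exists_isCoprime_shiftHom_iterate q hq hE0 hEs hQ hirr).1
    obtain ⟨N', hN1', hN'⟩ := (exists_isCoprime_shiftHom_iterate q hq hW0 hWs hQ hirr).2
    refine IsCoprime.mul_right ?_ ?_
    · refine IsCoprime.of_eq_mul_succ (x := fun n => τ^[n] E) (hiter _ _ hE) (fun n hn => ?_) hN1 hN
      rw [ofPolynomial_C_mul, iterate_map_mul, isCoprime_mul_unit_left_right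
        (isUnit_shiftHom_iterate _ (isUnit_single 0 (inv_ne_zero hP)) n),
        shiftHom_iterate_ofPolynomial]
      have := hcop n (by omega)
      rw [zpow_natCast] at this
      simpa [RootSystem.inv] using isCoprime_ofPolynomial (p := p) this
    · refine IsCoprime.of_eq_mul_succ (x := fun n => reflect (τ^[n] W))
        (y := fun n => reflect (τ^[n] (ofPolynomial (C P.leadingCoeff⁻¹ * P.reverse))))
        (fun n => by rw [← map_mul, ← hiter _ _ hW]) (fun n hn => ?_) hN1' hN'
      rw [← shiftHom_iterate_reflect, hrefl, iterate_map_mul, isCoprime_mul_unit_left_right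
        (isUnit_shiftHom_iterate _ (isUnit_single _ (inv_ne_zero hl)) n),
        shiftHom_iterate_ofPolynomial]
      have := hcop (-n) (by omega)
      rw [zpow_neg, zpow_natCast, ← inv_pow] at this
      exact isCoprime_ofPolynomial this

end PerfLaurent

namespace PerfLaurent

variable {p : ℕ} {K : Type*} [NontriviallyNormedField K] [Fact p.Prime] [IsUltrametricDist K]
  [CompleteSpace K]

/-! ### Characteristic zero: the derivation `X d/dX` -/

section CharZero

variable [CharZero K]

/-- The operator `X d/dX`. -/
noncomputable def eulerOperator (g : PerfLaurent p K) : PerfLaurent p K where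
  coeff e := (e : K) * g.coeff e
  bounded_denom := by
    obtain ⟨i, hi⟩ := g.bounded_denom
    exact ⟨i, fun e he => hi e (right_ne_zero_of_mul he)⟩
  converges r hr := by
    obtain ⟨i, hi⟩ := g.bounded_denom
    have h := (g.converges r hr).const_mul ‖((p : K) ^ i)⁻¹‖
    rw [mul_zero] at h
    refine squeeze_zero (fun e => by positivity) (fun e => ?_) h
    by_cases he : g.coeff e = 0
    · simp [he]
    · obtain ⟨k, rfl⟩ := hi e he
      rw [norm_mul, ← mul_assoc]
      gcongr
      push_cast
      rw [div_eq_mul_inv, norm_mul]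
      exact mul_le_of_le_one_left (norm_nonneg _) (IsUltrametricDist.norm_intCast_le_one K k)

theorem coeff_eulerOperator (g : PerfLaurent p K) (e : ℚ) :
    (eulerOperator g).coeff e = (e : K) * g.coeff e := rfl

/-- The derivation `X d/dX`. -/
noncomputable def eulerDerivation : Derivation K (PerfLaurent p K) (PerfLaurent p K) :=
  Derivation.mk'
    { toFun := eulerOperator
      map_add' := fun a b => by ext e; simp [mul_add, coeff_eulerOperator]
      map_smul' := fun c a => by ext e; simp [coeff_smul, coeff_eulerOperator]; ring }
    fun a b => by
      ext e
      simp only [LinearMap.coe_mk, AddHom.coe_mk, smul_eq_mul, coeff_add]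
      rw [PerfLaurent.mul_comm' b, coeff_eulerOperator, coeff_mul, coeff_mul, coeff_mul,
        ← (summable_mul _ _ e).tsum_add (summable_mul _ _ e), ← tsum_mul_left]
      refine tsum_congr fun k => ?_
      simp only [coeff_eulerOperator]
      push_cast
      ring

theorem eulerDerivation_single (n : ℤ) (c : K) :
    eulerDerivation (single n c : PerfLaurent p K) = single n (n * c) := by
  ext e
  change (e : K) * _ = _
  rw [coeff_single, coeff_single]
  split_ifs with h
  · rw [h, Rat.cast_intCast]
  · rw [mul_zero]

/-- The derivation sends `P` to `X P'`, where `X` is a unit, and `P` is separable in characteristic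
zero. -/
theorem isCoprime_eulerDerivation {P : K[X]} (hirr : Irreducible P) :
    IsCoprime (ofPolynomial P : PerfLaurent p K) (eulerDerivation (ofPolynomial P)) := by
  have h1 : eulerDerivation (ofPolynomial P : PerfLaurent p K) =
      ofPolynomial (derivative P) * single 1 1 := by
    rw [ofPolynomial_eq_aeval, Derivation.map_aeval, eulerDerivation_single, ofPolynomial_eq_aeval]
    simp
  rw [h1, isCoprime_mul_unit_right_right (isUnit_single 1 one_ne_zero)]
  exact isCoprime_ofPolynomial hirr.separable

theorem dvd_of_pow_eq_pow {φ : PerfLaurent p K} (hφ : φ ≠ 0)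
    (hcop : IsCoprime φ (eulerDerivation φ)) {s : PerfLaurent p K} {N k : ℕ} (hN : N ≠ 0)
    (hk : k ≠ 0) (hs : s ^ N = φ ^ k) : φ ∣ s := by
  have h1 := congrArg eulerDerivation hs
  rw [Derivation.leibniz_pow, Derivation.leibniz_pow] at h1
  simp only [nsmul_eq_mul, smul_eq_mul] at h1
  have hs' : s ^ (N - 1) * s = s ^ N := pow_sub_one_mul hN s
  have hφ' : φ ^ (k - 1) * φ = φ ^ k := pow_sub_one_mul hk φ
  -- The logarithmic derivative of `s ^ N = φ ^ k` with denominators cleared. Since `φ` is coprime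
  -- to its derivative and `k` is invertible, `φ` divides `s`.
  have h2 : φ * (N * eulerDerivation s) = (k : PerfLaurent p K) * s * eulerDerivation φ := by
    refine mul_left_cancel₀ (pow_ne_zero k hφ) ?_
    have : s ^ N * (φ * (N * eulerDerivation s)) =
        φ ^ k * ((k : PerfLaurent p K) * s * eulerDerivation φ) := by
      rw [← hs', ← hφ']
      linear_combination s * φ * h1
    rw [← this, hs]
  have h3 : φ ∣ (k : PerfLaurent p K) * s := hcop.dvd_of_dvd_mul_right ⟨_, h2.symm⟩
  have hk' : IsUnit (k : PerfLaurent p K) := by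
    rw [← map_natCast (algebraMap K (PerfLaurent p K))]
    exact (isUnit_iff_ne_zero.mpr (Nat.cast_ne_zero.mpr hk)).map _
  exact (hk'.dvd_mul_left).mp h3

end CharZero

/-! ### Characteristic `p`: Frobenius on functions -/

section CharP

theorem norm_coeff_pow_le (t : PerfLaurent p K) {ε : ℝ} (hε : 0 ≤ ε) (ht : ∀ e, ‖t.coeff e‖ ≤ ε)
    (n : ℕ) (e : ℚ) : ‖(t ^ n).coeff e‖ ≤ ε ^ n := by
  induction n generalizing e with
  | zero =>
    rw [pow_zero, coeff_one]
    split_ifs <;> simp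
  | succ n ih =>
    rw [pow_succ, coeff_mul, pow_succ]
    refine norm_tsum_le_of_forall_ultra (by positivity) fun k => ?_
    rw [norm_mul]
    exact mul_le_mul (ih k) (ht _) (norm_nonneg _) (by positivity)

theorem coeff_pow_of_monomial {u : PerfLaurent p K} {e₀ : ℚ} (hu : ∀ e ≠ e₀, u.coeff e = 0)
    (n : ℕ) (e : ℚ) : (u ^ n).coeff e = if e = n * e₀ then u.coeff e₀ ^ n else 0 := by
  induction n generalizing e with
  | zero => simp [coeff_one]
  | succ n ih =>
    rw [pow_succ', coeff_mul, tsum_eq_single e₀ fun k hk => by rw [hu k hk, zero_mul], ih, pow_succ']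
    have : e - e₀ = n * e₀ ↔ e = ((n + 1 : ℕ) : ℚ) * e₀ := by
      push_cast
      constructor <;> intro h <;> linarith
    simp [this]

/-- The part of a series with exponents in a finite set. -/
def restrict (t : PerfLaurent p K) (S : Finset ℚ) : PerfLaurent p K where
  coeff e := if e ∈ S then t.coeff e else 0
  bounded_denom := by
    obtain ⟨i, hi⟩ := t.bounded_denom
    exact ⟨i, fun e he => hi e fun h => he (by simp [h])⟩
  converges r _ := converges_of_finite (S.finite_toSet.subset fun e he => by
    by_contra h
    exact he (if_neg h)) r

theorem coeff_restrict (t : PerfLaurent p K) (S : Finset ℚ) (e : ℚ) :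
    (t.restrict S).coeff e = if e ∈ S then t.coeff e else 0 := rfl

variable [CharP K p]

instance : CharP (PerfLaurent p K) p :=
  charP_of_injective_algebraMap (FaithfulSMul.algebraMap_injective K (PerfLaurent p K)) p

/-- Both sides are additive in `t` and agree on monomials, hence on finite sums. In general `t` is a
finite sum up to an error with coefficients of norm at most `δ`, which changes either side by at
most `δ ^ p`. -/
theorem coeff_pow_char (t : PerfLaurent p K) (e : ℚ) : (t ^ p).coeff e = t.coeff (e / p) ^ p := by
  have hp : (p : ℚ) ≠ 0 := Nat.cast_ne_zero.mpr (Fact.out : p.Prime).ne_zero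
  have hadd (a b : PerfLaurent p K) (ha : (a ^ p).coeff e = a.coeff (e / p) ^ p)
      (hb : (b ^ p).coeff e = b.coeff (e / p) ^ p) :
      ((a + b) ^ p).coeff e = (a + b).coeff (e / p) ^ p := by
    rw [add_pow_char, coeff_add, coeff_add, add_pow_char, ha, hb]
  have hfin (S : Finset ℚ) : (t.restrict S ^ p).coeff e = (t.restrict S).coeff (e / p) ^ p := by
    induction S using Finset.cons_induction with
    | empty =>
      have : t.restrict ∅ = 0 := by ext e; simp [coeff_restrict]
      rw [this]
      simp [(Fact.out : p.Prime).ne_zero]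
    | cons a S ha ih =>
      have : t.restrict (Finset.cons a S ha) = t.restrict {a} + t.restrict S := by
        ext e
        simp only [coeff_add, coeff_restrict, Finset.mem_cons, Finset.mem_singleton]
        by_cases h1 : e = a
        · subst h1
          simp [ha]
        · simp [h1]
      rw [this]
      refine hadd _ _ ?_ ih
      rw [coeff_pow_of_monomial (e₀ := a) fun e he => by simp [coeff_restrict, he]]
      have : e = p * a ↔ e / p = a := by
        rw [div_eq_iff hp, mul_comm]
      simp only [coeff_restrict, Finset.mem_singleton, this]
      split_ifs with h
      · rw [h]
      · rw [zero_pow (Fact.out : p.Prime).ne_zero]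
  rw [← sub_eq_zero, ← norm_le_zero_iff]
  refine le_of_forall_pos_le_add fun ε hε => ?_
  rw [zero_add]
  set δ := min 1 ε with hδ
  have hδ0 : 0 < δ := lt_min one_pos hε
  have hSfin : {k | ¬ ‖t.coeff k‖ < δ}.Finite := by
    have h := (tendsto_zero_iff_norm_tendsto_zero.mp t.tendsto_coeff).eventually (gt_mem_nhds hδ0)
    rwa [eventually_cofinite] at h
  set S := hSfin.toFinset with hS
  set t' := t - t.restrict S with ht'
  have ht'c (k : ℚ) : ‖t'.coeff k‖ ≤ δ := by
    have h1 : t'.coeff k = t.coeff k - (t.restrict S).coeff k := by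
      rw [ht', sub_eq_add_neg, coeff_add, coeff_neg, sub_eq_add_neg]
    rw [h1, coeff_restrict]
    split_ifs with h
    · simpa using hδ0.le
    · rw [sub_zero]
      by_contra! h2
      exact h (hSfin.mem_toFinset.mpr (not_lt.mpr h2.le))
  have htt : t = t' + t.restrict S := by rw [ht']; ring
  have h1 : (t ^ p).coeff e - t.coeff (e / p) ^ p = (t' ^ p).coeff e - t'.coeff (e / p) ^ p := by
    conv_lhs => rw [htt]
    rw [add_pow_char, coeff_add, coeff_add, add_pow_char, hfin]
    ring
  rw [h1]
  have hδp : δ ^ p ≤ ε :=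
    (pow_le_of_le_one hδ0.le (min_le_left _ _) (Fact.out : p.Prime).ne_zero).trans (min_le_right _ _)
  rw [sub_eq_add_neg]
  refine (IsUltrametricDist.norm_add_le_max _ _).trans (max_le ?_ ?_)
  · exact (norm_coeff_pow_le t' hδ0.le ht'c p e).trans hδp
  · rw [norm_neg, norm_pow]
    exact (pow_le_pow_left₀ (norm_nonneg _) (ht'c _) p).trans hδp

/-- Frobenius multiplies exponents by `p`, and the denominators are bounded. This is how division by
polynomials becomes applicable to all functions. -/
theorem hasIntExponents_pow_char_pow (g : PerfLaurent p K) :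
    ∃ i, HasIntExponents (g ^ p ^ i) := by
  have hp : (p : ℚ) ≠ 0 := Nat.cast_ne_zero.mpr (Fact.out : p.Prime).ne_zero
  have h (i : ℕ) (e : ℚ) : (g ^ p ^ i).coeff e = g.coeff (e / p ^ i) ^ p ^ i := by
    induction i generalizing e with
    | zero => simp
    | succ i ih =>
      rw [pow_succ, pow_mul, coeff_pow_char, ih, ← pow_mul, div_div, ← pow_succ']
  obtain ⟨i, hi⟩ := g.bounded_denom
  refine ⟨i, fun e he => ?_⟩
  rw [h] at he
  obtain ⟨k, hk⟩ := hi _ (ne_zero_pow (pow_ne_zero i (Fact.out : p.Prime).ne_zero) he)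
  exact ⟨k, by
    rwa [div_left_inj' (pow_ne_zero i hp)] at hk⟩

/-- The root is taken term by term. On each circle its term norms are the `p`-th roots of those of
`g`, so it converges. -/
theorem exists_pow_char_eq (hK : ∀ x : K, ∃ y : K, y ^ p = x) (g : PerfLaurent p K) :
    ∃ t : PerfLaurent p K, t ^ p = g := by
  have hp0 : p ≠ 0 := (Fact.out : p.Prime).ne_zero
  have hp : (p : ℚ) ≠ 0 := Nat.cast_ne_zero.mpr hp0
  choose ρ hρ using hK
  have hρ0 : ρ 0 = 0 := eq_zero_of_pow_eq_zero (hρ 0)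
  have hinj : Function.Injective fun e : ℚ => (p : ℚ) * e := mul_right_injective₀ hp
  let t : PerfLaurent p K :=
    { coeff := fun e => ρ (g.coeff (p * e))
      bounded_denom := by
        obtain ⟨i, hi⟩ := g.bounded_denom
        refine ⟨i + 1, fun e he => ?_⟩
        obtain ⟨k, hk⟩ := hi (p * e) fun h => he (by rw [h, hρ0])
        exact ⟨k, by rw [pow_succ, ← div_div, ← hk]; field_simp⟩
      converges := fun r hr => by
        have h1 := ((g.converges r hr).comp hinj.tendsto_cofinite).rpow_const (p := (p : ℝ)⁻¹)
          (Or.inr (by positivity))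
        rw [Real.zero_rpow (by positivity)] at h1
        refine h1.congr fun e => ?_
        have h2 : ‖g.coeff (p * e)‖ * r ^ ((p * e : ℚ) : ℝ) =
            (‖ρ (g.coeff (p * e))‖ * r ^ (e : ℝ)) ^ p := by
          rw [mul_pow, ← norm_pow, hρ, ← Real.rpow_natCast, ← Real.rpow_mul hr.le]
          push_cast
          rw [mul_comm (e : ℝ)]
        simp only [Function.comp_apply]
        rw [h2, Real.pow_rpow_inv_natCast (by positivity) hp0] }
  refine ⟨t, ?_⟩
  ext e
  rw [coeff_pow_char]
  change ρ (g.coeff (p * (e / p))) ^ p = _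
  rw [hρ, mul_div_cancel₀ _ hp]

theorem exists_pow_char_pow_eq (hK : ∀ x : K, ∃ y : K, y ^ p = x) (g : PerfLaurent p K) (i : ℕ) :
    ∃ t : PerfLaurent p K, t ^ p ^ i = g := by
  induction i with
  | zero => exact ⟨g, by simp⟩
  | succ i ih =>
    obtain ⟨t, ht⟩ := ih
    obtain ⟨s, hs⟩ := exists_pow_char_eq hK t
    exact ⟨s, by rw [pow_succ', pow_mul, hs, ht]⟩

/-- The cofactor is a `p ^ i`-th power, and Frobenius is injective. -/
theorem dvd_of_pow_char_pow_dvd (hK : ∀ x : K, ∃ y : K, y ^ p = x) {a b : PerfLaurent p K} {i : ℕ}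
    (h : a ^ p ^ i ∣ b ^ p ^ i) : a ∣ b := by
  obtain ⟨c, hc⟩ := h
  obtain ⟨t, rfl⟩ := exists_pow_char_pow_eq hK c i
  refine ⟨t, ?_⟩
  rw [← mul_pow, ← sub_eq_zero, ← sub_pow_char_pow (p := p)] at hc
  exact sub_eq_zero.mp (eq_zero_of_pow_eq_zero hc)

end CharP

end PerfLaurent

/-! ### Characteristic and perfectness of a perfectoid field -/

namespace IsPerfectoidField

variable {p : ℕ} {K : Type*} [NontriviallyNormedField K] [Fact p.Prime] [IsUltrametricDist K]
  [CompleteSpace K]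

theorem exists_pow_char_eq [CharP K p] (hK : IsPerfectoidField p K) (x : K) :
    ∃ y : K, y ^ p = x := by
  have h (x : K) (hx : ‖x‖ ≤ 1) : ∃ y : K, y ^ p = x := by
    obtain ⟨y, z, -, -, h⟩ := hK.frobenius_surjective x hx
    exact ⟨y, by rw [h, CharP.cast_eq_zero]; ring⟩
  rcases le_or_gt ‖x‖ 1 with hx | hx
  · exact h x hx
  · obtain ⟨y, hy⟩ := h x⁻¹ (by rw [norm_inv]; exact inv_le_one_of_one_le₀ hx.le)
    exact ⟨y⁻¹, by rw [inv_pow, hy, inv_inv]⟩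

/-- If the characteristic were another prime, `1` would be an integer multiple of `p` in `K`, hence
of norm less than one. -/
theorem charP_or_charZero (hK : IsPerfectoidField p K) : CharP K p ∨ CharZero K := by
  obtain ⟨c, hc⟩ := CharP.exists K
  rcases CharP.char_is_prime_or_zero K c with hprime | rfl
  · left
    by_cases hcp : c = p
    · rwa [← hcp]
    · exfalso
      have h1 : IsCoprime (c : ℤ) p :=
        Nat.isCoprime_iff_coprime.mpr ((Nat.coprime_primes hprime Fact.out).mpr hcp)
      obtain ⟨a, b, hab⟩ := h1
      have h2 := congrArg (Int.cast : ℤ → K) hab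
      push_cast at h2
      rw [CharP.cast_eq_zero K c, mul_zero, zero_add] at h2
      have h3 := congrArg norm h2
      rw [norm_mul, norm_one] at h3
      have h4 := IsUltrametricDist.norm_intCast_le_one K b
      have h5 := hK.norm_p_lt_one
      nlinarith [norm_nonneg (p : K), norm_nonneg (b : K)]
  · exact Or.inr (CharP.charP_to_charZero K)

end IsPerfectoidField

/-! ### Powers of the minimal polynomial and orders -/

namespace PerfMero

open PerfLaurent

variable {p : ℕ} {K : Type*} [NontriviallyNormedField K] [IsUltrametricDist K]
  [CompleteSpace K] [Fact p.Prime]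

theorem irreducible_minpoly (α : AlgebraicClosure K) : Irreducible (minpoly K α) :=
  minpoly.irreducible (Algebra.IsIntegral.isIntegral α)

theorem minpoly_coeff_zero_ne_zero {α : AlgebraicClosure K} (hα : α ≠ 0) :
    (minpoly K α).coeff 0 ≠ 0 :=
  minpoly.coeff_zero_ne_zero (Algebra.IsIntegral.isIntegral α) hα

theorem phi_ne_zero (α : AlgebraicClosure K) : phi p α ≠ 0 :=
  ofPolynomial_ne_zero (irreducible_minpoly α).ne_zero

theorem not_isUnit_phi {α : AlgebraicClosure K} (hα : α ≠ 0) : ¬ IsUnit (phi p α) :=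
  not_isUnit_ofPolynomial (minpoly_coeff_zero_ne_zero hα) (irreducible_minpoly α).natDegree_pos.ne'

theorem isPhiPower_zero (α : AlgebraicClosure K) : IsPhiPower α 0 (1 : PerfLaurent p K) :=
  ⟨0, 0, by simp, by simp⟩

theorem natCast_pos_pow (i : ℕ) : (0 : ℚ) < (p : ℚ) ^ i :=
  pow_pos (Nat.cast_pos.mpr (Fact.out : p.Prime).pos) i

theorem IsPhiPower.isCoprime {α : AlgebraicClosure K} {m : ℚ} {s u : PerfLaurent p K}
    (hs : IsPhiPower α m s) (hu : IsCoprime (phi p α) u) : IsCoprime s u := by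
  obtain ⟨i, k, -, h⟩ := hs
  rw [← IsCoprime.pow_left_iff (pow_pos (Fact.out : p.Prime).pos i), h]
  exact hu.pow_left

theorem IsPhiPower.phi_mul {α : AlgebraicClosure K} {m : ℚ} {s : PerfLaurent p K}
    (hs : IsPhiPower α m s) : IsPhiPower α (m + 1) (phi p α * s) := by
  obtain ⟨i, k, rfl, h⟩ := hs
  have := natCast_pos_pow (p := p) i
  refine ⟨i, k + p ^ i, ?_, ?_⟩
  · push_cast
    field_simp
  · rw [mul_pow, h]
    ring

theorem IsPhiPower.sub_one {α : AlgebraicClosure K} {m : ℚ} (hm : 1 ≤ m) {s : PerfLaurent p K}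
    (hs : IsPhiPower α m (phi p α * s)) : IsPhiPower α (m - 1) s := by
  obtain ⟨i, k, rfl, h⟩ := hs
  have hpos := natCast_pos_pow (p := p) i
  rw [le_div_iff₀ hpos, one_mul] at hm
  have hk : p ^ i ≤ k := by exact_mod_cast hm
  obtain ⟨l, rfl⟩ := Nat.exists_eq_add_of_le hk
  refine ⟨i, l, ?_, ?_⟩
  · push_cast
    field_simp
    ring
  · rw [mul_pow, pow_add] at h
    exact mul_left_cancel₀ (pow_ne_zero _ (phi_ne_zero α)) h

/-- This makes `ord_α` grow by exactly one under multiplication by `φ_α`: one factor `φ_α` can be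
removed from any power with exponent at least one. -/
theorem IsPhiPower.phi_dvd (hK : IsPerfectoidField p K) {α : AlgebraicClosure K} {m : ℚ}
    (hm : 1 ≤ m) {s : PerfLaurent p K} (hs : IsPhiPower α m s) : phi p α ∣ s := by
  obtain ⟨i, k, rfl, h⟩ := hs
  rw [le_div_iff₀ (natCast_pos_pow i), one_mul] at hm
  have hk : p ^ i ≤ k := by exact_mod_cast hm
  have hpi : 0 < p ^ i := pow_pos (Fact.out : p.Prime).pos i
  rcases hK.charP_or_charZero with h0 | h0
  · exact dvd_of_pow_char_pow_dvd hK.exists_pow_char_eq (i := i) (by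
      rw [h]; exact pow_dvd_pow _ hk)
  · exact dvd_of_pow_eq_pow (phi_ne_zero α) (isCoprime_eulerDerivation (irreducible_minpoly α))
      hpi.ne' (by omega) h

/-- In characteristic zero the exponents of the powers of `φ_α` are integers. -/
theorem IsPhiPower.exists_natCast [CharZero K] {α : AlgebraicClosure K} (hα : α ≠ 0) {m : ℚ}
    {s : PerfLaurent p K} (hs : IsPhiPower α m s) : ∃ n : ℕ, m = n ∧ phi p α ^ n ∣ s := by
  obtain ⟨i, k, rfl, h⟩ := hs
  have hpi : 0 < p ^ i := pow_pos (Fact.out : p.Prime).pos i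
  induction k using Nat.strong_induction_on generalizing s with
  | _ k ih =>
    rcases Nat.eq_zero_or_pos k with rfl | hk
    · exact ⟨0, by simp, by simp⟩
    obtain ⟨s', rfl⟩ := dvd_of_pow_eq_pow (phi_ne_zero α)
      (isCoprime_eulerDerivation (irreducible_minpoly α)) hpi.ne' hk.ne' h
    -- Once `φ` divides `s`, `φ ^ (p ^ i)` divides `s ^ (p ^ i) = φ ^ k`; as `φ` is neither zero nor
    -- a unit, exponents can be compared.
    have hk' : p ^ i ≤ k := by
      rw [← pow_dvd_pow_iff (phi_ne_zero α) (not_isUnit_phi (p := p) hα), ← h, mul_pow]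
      exact dvd_mul_right _ _
    obtain ⟨l, rfl⟩ := Nat.exists_eq_add_of_le hk'
    rw [mul_pow, pow_add] at h
    obtain ⟨n, hn, hdvd⟩ := ih l (by omega) (mul_left_cancel₀ (pow_ne_zero _ (phi_ne_zero α)) h)
    refine ⟨n + 1, ?_, ?_⟩
    · have := natCast_pos_pow (p := p) i
      push_cast
      rw [← hn]
      field_simp
      ring
    · rw [pow_succ']
      exact mul_dvd_mul_left _ hdvd

/-- In characteristic `p` the order is `n / p ^ i`, where `n` is the multiplicity of `φ_α` in `g ^
(p ^ i)` and `i` makes the exponents integral. In characteristic zero only integral exponents occur,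
and the zero count bounds them. -/
theorem exists_holHasOrd (hK : IsPerfectoidField p K) {α : AlgebraicClosure K} (hα : α ≠ 0)
    {g : PerfLaurent p K} (hg : g ≠ 0) : ∃ m, HolHasOrd g α m := by
  rcases hK.charP_or_charZero with h0 | h0
  · obtain ⟨i, hi⟩ := hasIntExponents_pow_char_pow g
    obtain ⟨n, g', hn, hcop⟩ := hi.exists_eq_pow_mul (minpoly_coeff_zero_ne_zero hα)
      (irreducible_minpoly α) (pow_ne_zero _ hg)
    change g ^ p ^ i = phi p α ^ n * g' at hn
    change IsCoprime (phi p α) g' at hcop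
    refine ⟨n / (p : ℚ) ^ i, ?_, ?_⟩
    · obtain ⟨s, hs⟩ := exists_pow_char_pow_eq hK.exists_pow_char_eq (phi p α ^ n) i
      exact ⟨s, ⟨i, n, rfl, hs⟩, dvd_of_pow_char_pow_dvd hK.exists_pow_char_eq (i := i)
        (by rw [hs, hn]; exact dvd_mul_right _ _)⟩
    · rintro m ⟨s, hs, hsg⟩
      have h1 : s ^ p ^ i ∣ phi p α ^ n :=
        (hs.isCoprime hcop).pow_left.dvd_of_dvd_mul_right (hn ▸ pow_dvd_pow_of_dvd hsg _)
      obtain ⟨j, k, rfl, h⟩ := hs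
      -- The power `s` has its own denominator `p ^ j`; passing to the common exponent `p ^ (i + j)`
      -- compares ordinary powers of `φ_α`.
      have h2 := pow_dvd_pow_of_dvd h1 (p ^ j)
      rw [← pow_mul, mul_comm, pow_mul, h, ← pow_mul, ← pow_mul,
        pow_dvd_pow_iff (phi_ne_zero α) (not_isUnit_phi hα)] at h2
      rw [div_le_div_iff₀ (natCast_pos_pow j) (natCast_pos_pow i)]
      exact_mod_cast h2
  · obtain ⟨N, hN⟩ := exists_not_pow_dvd (minpoly_coeff_zero_ne_zero hα)
      (irreducible_minpoly α).natDegree_pos.ne' hg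
    have hbdd : BddAbove {n : ℕ | phi p α ^ n ∣ g} := ⟨N, fun n hn => hN n hn⟩
    have hmem := Nat.sSup_mem ⟨0, by simp⟩ hbdd
    refine ⟨(sSup {n : ℕ | phi p α ^ n ∣ g} : ℕ), ⟨_, ⟨0, sSup {n : ℕ | phi p α ^ n ∣ g}, by simp, by simp⟩, hmem⟩, ?_⟩
    rintro m ⟨s, hs, hsg⟩
    obtain ⟨n, rfl, hn⟩ := hs.exists_natCast hα
    exact_mod_cast le_csSup hbdd (hn.trans hsg)

theorem holHasOrd_mul_iff {α : AlgebraicClosure K} {g u : PerfLaurent p K}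
    (hu : IsCoprime (phi p α) u) (m : ℚ) : HolHasOrd (g * u) α m ↔ HolHasOrd g α m := by
  have : {m' : ℚ | ∃ s : PerfLaurent p K, IsPhiPower α m' s ∧ s ∣ g * u} =
      {m' : ℚ | ∃ s : PerfLaurent p K, IsPhiPower α m' s ∧ s ∣ g} := by
    ext m'
    exact ⟨fun ⟨s, hs, h⟩ => ⟨s, hs, (hs.isCoprime hu).dvd_of_dvd_mul_right h⟩,
      fun ⟨s, hs, h⟩ => ⟨s, hs, h.mul_right u⟩⟩
  rw [HolHasOrd, HolHasOrd, this]

theorem HolHasOrd.phi_mul (hK : IsPerfectoidField p K) {α : AlgebraicClosure K}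
    {g : PerfLaurent p K} {m : ℚ} (hg : HolHasOrd g α m) : HolHasOrd (phi p α * g) α (m + 1) := by
  obtain ⟨⟨s, hs, hsg⟩, hmax⟩ := hg
  refine ⟨⟨_, hs.phi_mul, mul_dvd_mul_left _ hsg⟩, ?_⟩
  rintro m' ⟨t, ht, htg⟩
  have h0 : 0 ≤ m := hmax ⟨1, isPhiPower_zero α, one_dvd g⟩
  rcases le_or_gt 1 m' with h1 | h1
  · obtain ⟨t', rfl⟩ := ht.phi_dvd hK h1
    have := hmax ⟨t', ht.sub_one h1, (mul_dvd_mul_iff_left (phi_ne_zero α)).mp htg⟩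
    linarith
  · linarith

theorem mul_eq_mul_of_div_eq_div {A B g h : PerfLaurent p K} (hB : B ≠ 0) (hh : h ≠ 0)
    (H : (algebraMap (PerfLaurent p K) (PerfMero p K) A / algebraMap _ _ B) =
      algebraMap (PerfLaurent p K) (PerfMero p K) g / algebraMap (PerfLaurent p K) _ h) :
    h * A = g * B := by
  have hinj := IsFractionRing.injective (PerfLaurent p K) (PerfMero p K)
  have hB' : algebraMap (PerfLaurent p K) (PerfMero p K) B ≠ 0 :=
    (map_ne_zero_iff _ hinj).mpr hB
  have hh' : algebraMap (PerfLaurent p K) (PerfMero p K) h ≠ 0 :=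
    (map_ne_zero_iff _ hinj).mpr hh
  rw [div_eq_div_iff hB' hh', ← map_mul, ← map_mul] at H
  rw [mul_comm]
  exact hinj H

theorem hasOrd_zero_of_isCoprime (hK : IsPerfectoidField p K) {α : AlgebraicClosure K}
    (hα : α ≠ 0) {A B : PerfLaurent p K} (hB0 : B ≠ 0) (hA : IsCoprime (phi p α) A)
    (hB : IsCoprime (phi p α) B) : HasOrd (algebraMap (PerfLaurent p K) (PerfMero p K) A /
      algebraMap (PerfLaurent p K) (PerfMero p K) B) α 0 := by
  intro g h hh H
  have H' := mul_eq_mul_of_div_eq_div hB0 hh H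
  obtain ⟨b, hb⟩ := exists_holHasOrd hK hα hh
  refine ⟨b, b, ?_, hb, sub_self b⟩
  rwa [← holHasOrd_mul_iff hB, ← H', holHasOrd_mul_iff hA]

/-- Any other fraction `g / h` satisfies `g B = h φ_α A`, and the coprime factors `A` and `B` can be
dropped when orders are computed. -/
theorem hasOrd_one_of_isCoprime (hK : IsPerfectoidField p K) {α : AlgebraicClosure K}
    (hα : α ≠ 0) {A B : PerfLaurent p K} (hB0 : B ≠ 0) (hA : IsCoprime (phi p α) A)
    (hB : IsCoprime (phi p α) B) :
    HasOrd (algebraMap (PerfLaurent p K) (PerfMero p K) (phi p α * A) /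
      algebraMap (PerfLaurent p K) (PerfMero p K) B) α 1 := by
  intro g h hh H
  have H' := mul_eq_mul_of_div_eq_div hB0 hh H
  obtain ⟨b, hb⟩ := exists_holHasOrd hK hα hh
  refine ⟨b + 1, b, ?_, hb, by ring⟩
  rw [← holHasOrd_mul_iff hB, ← H', ← mul_assoc, holHasOrd_mul_iff hA, mul_comm]
  exact hb.phi_mul hK

end PerfMero

/-! ### Choice of the scaling and construction of the periodic function -/

namespace PerfMero

open PerfLaurent

variable {p : ℕ} {K : Type*} [NontriviallyNormedField K] [IsUltrametricDist K]
  [CompleteSpace K] [Fact p.Prime]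

theorem comp_scale_comp_scale (P : K[X]) (a b : K) :
    (P.comp (C a * X)).comp (C b * X) = P.comp (C (a * b) * X) := by
  rw [Polynomial.comp_assoc]
  congr 1
  simp [mul_assoc]

theorem aeval_comp_scale (P : K[X]) (x : K) (γ : AlgebraicClosure K) :
    aeval γ (P.comp (C x * X)) = aeval (algebraMap K _ x * γ) P := by
  rw [Polynomial.aeval_comp]
  simp

theorem isCoprime_minpoly_comp_scale {α γ : AlgebraicClosure K} {x : K}
    (h : ¬ IsConjRoot K α (algebraMap K _ x * γ)) :
    IsCoprime (minpoly K γ) ((minpoly K α).comp (C x * X)) := by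
  refine (_root_.dvd_or_isCoprime _ _ (irreducible_minpoly γ)).resolve_left fun hdvd => h ?_
  refine isConjRoot_of_aeval_eq_zero (Algebra.IsIntegral.isIntegral α) ?_
  rw [← aeval_comp_scale]
  exact aeval_eq_zero_of_dvd_aeval_eq_zero hdvd (minpoly.aeval K γ)

theorem natDegree_comp_scale (P : K[X]) {x : K} (hx : x ≠ 0) :
    (P.comp (C x * X)).natDegree = P.natDegree := by
  rw [Polynomial.natDegree_comp, Polynomial.natDegree_C_mul_X x hx, mul_one]

theorem leadingCoeff_comp_scale (P : K[X]) {x : K} (hx : x ≠ 0) :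
    (P.comp (C x * X)).leadingCoeff = P.leadingCoeff * x ^ P.natDegree := by
  rw [Polynomial.leadingCoeff_comp (by rw [Polynomial.natDegree_C_mul_X x hx]; exact one_ne_zero)]
  simp

theorem coeff_zero_comp_scale (P : K[X]) (x : K) : (P.comp (C x * X)).coeff 0 = P.coeff 0 := by
  rw [Polynomial.comp_C_mul_X_coeff, pow_zero, mul_one]

/-- If `xγ` is conjugate to `α`, then `φ_α(xX)` and `φ_γ` divide each other up to scaling, so they
agree up to the leading coefficient. The constant terms then determine `|x|`, which allows conjugacy
to be excluded by norms. -/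
theorem coeff_zero_eq_of_isConjRoot {α γ : AlgebraicClosure K} {x : K} (hx : x ≠ 0)
    (h : IsConjRoot K α (algebraMap K _ x * γ)) : (minpoly K α).coeff 0 =
      x ^ (minpoly K α).natDegree * (minpoly K γ).coeff 0 := by
  have hmα : (minpoly K α).Monic := minpoly.monic (Algebra.IsIntegral.isIntegral α)
  have hmγ : (minpoly K γ).Monic := minpoly.monic (Algebra.IsIntegral.isIntegral γ)
  have h1 : minpoly K γ ∣ (minpoly K α).comp (C x * X) := minpoly.dvd K γ (by
    rw [aeval_comp_scale, h]
    exact minpoly.aeval K _)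
  have h2 : minpoly K α ∣ (minpoly K γ).comp (C x⁻¹ * X) := by
    rw [h]
    refine minpoly.dvd K _ ?_
    rw [aeval_comp_scale, ← mul_assoc, ← map_mul, inv_mul_cancel₀ hx, map_one, one_mul]
    exact minpoly.aeval K γ
  have h3 := Polynomial.natDegree_le_of_dvd h2 fun h0 => by
    have := leadingCoeff_comp_scale (minpoly K γ) (inv_ne_zero hx)
    rw [h0, leadingCoeff_zero, hmγ.leadingCoeff, one_mul] at this
    exact pow_ne_zero _ (inv_ne_zero hx) this.symm
  rw [natDegree_comp_scale _ (inv_ne_zero hx)] at h3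
  have h4 := Polynomial.eq_leadingCoeff_mul_of_monic_of_dvd_of_natDegree_le hmγ h1
    (by rwa [natDegree_comp_scale _ hx])
  have h5 := congrArg (fun P => P.coeff 0) h4
  simp only [Polynomial.coeff_C_mul] at h5
  rwa [coeff_zero_comp_scale, leadingCoeff_comp_scale _ hx, hmα.leadingCoeff, one_mul] at h5

/-- There are `a` such that neither `‖a‖` nor `‖a‖ ^ 2` lies in `Q ^ ℤ ∪ t * Q ^ ℤ`. -/
theorem exists_norm_pow_mul_zpow_ne (hK : IsPerfectoidField p K) {Q t : ℝ} (hQ0 : 0 < Q)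
    (hQ1 : Q < 1) (ht : 0 < t) : ∃ a : K, a ≠ 0 ∧
      ∀ j : ℕ, j = 1 ∨ j = 2 → ∀ n : ℤ, ‖a‖ ^ j * Q ^ n ≠ 1 ∧ ‖a‖ ^ j * Q ^ n ≠ t := by
  have hr : 1 < Q⁻¹ := (one_lt_inv₀ hQ0).mpr hQ1
  -- Write `t = ε * r ^ m` with `1 < ε ≤ r`. The open interval from `1` to `ε` contains no point of
  -- `r ^ ℤ` or `ε * r ^ ℤ`, and `1 < ‖a‖ < √ε` puts both `‖a‖` and `‖a‖ ^ 2` into it.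
  obtain ⟨m, hm1, hm2⟩ := exists_mem_Ioc_zpow ht hr
  set r := Q⁻¹ with hrdef
  have hr0 : 0 < r := inv_pos.mpr hQ0
  set ε := t / r ^ m with hε
  have hε1 : 1 < ε := (one_lt_div (zpow_pos hr0 m)).mpr hm1
  have hεr : ε ≤ r := by
    rw [hε, div_le_iff₀ (zpow_pos hr0 m)]
    rwa [zpow_add_one₀ hr0.ne', mul_comm] at hm2
  obtain ⟨a, ha1, ha2⟩ := hK.not_discrete (Real.sqrt ε) (by
    rw [Real.lt_sqrt zero_le_one]; simpa using hε1)
  refine ⟨a, norm_pos_iff.mp (one_pos.trans ha1), fun j hj n => ?_⟩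
  have hsq : ‖a‖ ^ 2 < ε := (Real.lt_sqrt (norm_nonneg a)).mp ha2
  have hy1 : 1 < ‖a‖ ^ j := one_lt_pow₀ ha1 (by omega)
  have hy2 : ‖a‖ ^ j < ε := (pow_le_pow_right₀ ha1.le (by omega)).trans_lt hsq
  have hQn : Q ^ n = (r ^ n)⁻¹ := by rw [hrdef, inv_zpow, inv_inv]
  have hrn : 0 < r ^ n := zpow_pos hr0 n
  rw [hQn]
  constructor
  · intro h
    rw [mul_inv_eq_one₀ hrn.ne'] at h
    rcases le_or_gt n 0 with hn | hn
    · have := zpow_le_one_of_nonpos₀ hr.le hn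
      linarith
    · have : r ^ (1 : ℤ) ≤ r ^ n := zpow_le_zpow_right₀ hr.le (by omega)
      rw [zpow_one] at this
      linarith
  · intro h
    rw [mul_inv_eq_iff_eq_mul₀ hrn.ne'] at h
    have h1 : ‖a‖ ^ j = ε * r ^ (m + n) := by
      rw [h, hε, zpow_add₀ hr0.ne']
      field_simp
    rcases le_or_gt 0 (m + n) with hn | hn
    · have : 1 ≤ r ^ (m + n) := one_le_zpow₀ hr.le hn
      nlinarith
    · have h2 : r ^ (m + n) ≤ r ^ (-1 : ℤ) := zpow_le_zpow_right₀ hr.le (by omega)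
      rw [zpow_neg_one] at h2
      have h3 : ε * r ^ (m + n) ≤ r * r⁻¹ := mul_le_mul hεr h2 (zpow_pos hr0 _).le hr0.le
      rw [mul_inv_cancel₀ hr0.ne'] at h3
      linarith

theorem shift_algebraMap (q : RootSystem p K) (g : PerfLaurent p K) :
    shift q (algebraMap (PerfLaurent p K) (PerfMero p K) g) = algebraMap _ _ (shiftHom q g) := by
  rw [shift, IsFractionRing.map, IsLocalization.map_eq]

theorem isPeriodic_div (q : RootSystem p K) {A B S : PerfLaurent p K} (hS : S ≠ 0)
    (hA : shiftHom q A = S * A) (hB : shiftHom q B = S * B) :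
    IsPeriodic q (algebraMap (PerfLaurent p K) (PerfMero p K) A /
      algebraMap (PerfLaurent p K) (PerfMero p K) B) := by
  have hS' : algebraMap (PerfLaurent p K) (PerfMero p K) S ≠ 0 :=
    (map_ne_zero_iff _ (IsFractionRing.injective (PerfLaurent p K) (PerfMero p K))).mpr hS
  rw [IsPeriodic, map_div₀, shift_algebraMap, shift_algebraMap, hA, hB, map_mul, map_mul,
    mul_div_mul_left _ _ hS']

theorem exists_isPeriodic (hK : IsPerfectoidField p K) (q : RootSystem p K)
    (hq : ‖q.seq 0‖ < 1) {α β : AlgebraicClosure K} (hα : α ≠ 0) (hβ : β ≠ 0) :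
    ∃ f : PerfMero p K, IsPeriodic q f ∧ HasOrd f α 1 ∧
      (¬ IsConjModQ q α β → HasOrd f β 0) := by
  have hq0 : 0 < ‖q.seq 0‖ := norm_pos_iff.mpr q.ne_zero
  set φ := minpoly K α with hφ
  set d := φ.natDegree with hd
  have hd0 : d ≠ 0 := (irreducible_minpoly α).natDegree_pos.ne'
  have hα0 : 0 < ‖φ.coeff 0‖ := norm_pos_iff.mpr (minpoly_coeff_zero_ne_zero hα)
  have hβ0 : 0 < ‖(minpoly K β).coeff 0‖ := norm_pos_iff.mpr (minpoly_coeff_zero_ne_zero hβ)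
  set c := ‖φ.coeff 0‖ / ‖(minpoly K β).coeff 0‖ with hc
  have hc0 : 0 < c := div_pos hα0 hβ0
  -- The value of `t` is the only possible norm of an `x ∈ K` for which `xβ` is conjugate to `α`;
  -- for `xα` that norm is `1`.
  obtain ⟨a, ha0, ha⟩ := exists_norm_pow_mul_zpow_ne (t := c ^ (d : ℝ)⁻¹) hK hq0 hq
    (Real.rpow_pos_of_pos hc0 _)
  have hqn (n : ℤ) : q.seq 0 ^ n ≠ 0 := zpow_ne_zero _ q.ne_zero
  have hconjα {x : K} (hx : x ≠ 0) (hx1 : ‖x‖ ≠ 1) : ¬ IsConjRoot K α (algebraMap K _ x * α) :=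
    fun h => by
      have h1 := congrArg norm (coeff_zero_eq_of_isConjRoot hx h)
      rw [norm_mul, norm_pow, eq_comm, mul_eq_right₀ hα0.ne'] at h1
      exact hx1 ((pow_eq_one_iff_of_nonneg (norm_nonneg x) hd0).mp h1)
  have hconjβ {x : K} (hx : x ≠ 0) (hx1 : ‖x‖ ≠ c ^ (d : ℝ)⁻¹) :
      ¬ IsConjRoot K α (algebraMap K _ x * β) := fun h => by
    have h1 := congrArg norm (coeff_zero_eq_of_isConjRoot hx h)
    rw [norm_mul, norm_pow] at h1
    have h2 : c = ‖x‖ ^ d := by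
      rw [hc, div_eq_iff hβ0.ne']
      exact h1
    exact hx1 (by rw [h2, Real.pow_rpow_inv_natCast (norm_nonneg x) hd0])
  have hnorm (j : ℕ) (n : ℤ) : ‖a ^ j * q.seq 0 ^ n‖ = ‖a‖ ^ j * ‖q.seq 0‖ ^ n := by
    rw [norm_mul, norm_pow, norm_zpow]
  have hP0 (j : ℕ) : (φ.comp (C (a ^ j) * X)).coeff 0 ≠ 0 := by
    rw [coeff_zero_comp_scale]
    exact norm_pos_iff.mp hα0
  choose Θ hΘ0 hΘ hΘcop using fun j => exists_theta q hq (hP0 j)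
  set F : ℕ → PerfLaurent p K := fun j => ofPolynomial (φ.comp (C (a ^ j) * X)) * Θ j with hF
  have hφ0 : φ ≠ 0 := (irreducible_minpoly α).ne_zero
  have hF0 (j : ℕ) : F j ≠ 0 :=
    mul_ne_zero (ofPolynomial_ne_zero fun h0 => hP0 j (by rw [h0, Polynomial.coeff_zero])) (hΘ0 j)
  have hmul (j : ℕ) : shiftHom q (F j) =
      single d ((a ^ j) ^ d / φ.coeff 0 / q.seq 0 ^ d) * F j := by
    have := hΘ j
    rwa [natDegree_comp_scale _ (pow_ne_zero j ha0), leadingCoeff_comp_scale _ (pow_ne_zero j ha0),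
      coeff_zero_comp_scale, (minpoly.monic (Algebra.IsIntegral.isIntegral α)).leadingCoeff,
      one_mul] at this
  have hΘcop' {γ : AlgebraicClosure K} (hγ : γ ≠ 0) (j : ℕ) (h : ∀ n : ℤ, n ≠ 0 →
      ¬ IsConjRoot K α (algebraMap K _ (a ^ j * q.seq 0 ^ n) * γ)) :
      IsCoprime (phi p γ) (Θ j) :=
    hΘcop j _ (irreducible_minpoly γ) (minpoly_coeff_zero_ne_zero hγ) fun n hn => by
      rw [comp_scale_comp_scale]
      exact isCoprime_minpoly_comp_scale (h n hn)
  have hFcop {γ : AlgebraicClosure K} (hγ : γ ≠ 0) (j : ℕ) (h : ∀ n : ℤ,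
      ¬ IsConjRoot K α (algebraMap K _ (a ^ j * q.seq 0 ^ n) * γ)) :
      IsCoprime (phi p γ) (F j) := by
    refine IsCoprime.mul_right (isCoprime_ofPolynomial (isCoprime_minpoly_comp_scale ?_))
      (hΘcop' hγ j fun n _ => h n)
    simpa using h 0
  have hFα (j : ℕ) (hj : j = 1 ∨ j = 2) : IsCoprime (phi p α) (F j) :=
    hFcop hα j fun n => hconjα (mul_ne_zero (pow_ne_zero j ha0) (hqn n)) (by
      rw [hnorm]; exact (ha j hj n).1)
  have hFβ (j : ℕ) (hj : j = 1 ∨ j = 2) : IsCoprime (phi p β) (F j) :=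
    hFcop hβ j fun n => hconjβ (mul_ne_zero (pow_ne_zero j ha0) (hqn n)) (by
      rw [hnorm]; exact (ha j hj n).2)
  have hΘα : IsCoprime (phi p α) (Θ 0) := hΘcop' hα 0 fun n hn => by
    refine hconjα (mul_ne_zero (pow_ne_zero 0 ha0) (hqn n)) fun h => ?_
    rw [hnorm, pow_zero, one_mul] at h
    exact hn ((zpow_eq_one_iff_right₀ hq0.le hq.ne).mp h)
  have hF0eq : F 0 = phi p α * Θ 0 := by
    simp [hF, phi, hφ]
  -- The multiplier of `F j` depends on `j` through `(a ^ j) ^ d`, and `0 + 2 = 1 + 1`. The simple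
  -- quotient of `F 0` by `F 1` would leave a factor `a ^ d`.
  refine ⟨algebraMap (PerfLaurent p K) (PerfMero p K) (F 0 * F 2) /
    algebraMap (PerfLaurent p K) (PerfMero p K) (F 1 * F 1), ?_, ?_, fun hconj => ?_⟩
  · refine isPeriodic_div q (S := single d (a ^ d / φ.coeff 0 / q.seq 0 ^ d) *
      single d (a ^ d / φ.coeff 0 / q.seq 0 ^ d)) ?_ ?_ ?_
    · have hne : a ^ d / φ.coeff 0 / q.seq 0 ^ d ≠ 0 :=
        div_ne_zero (div_ne_zero (pow_ne_zero d ha0) (norm_pos_iff.mp hα0))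
          (pow_ne_zero d q.ne_zero)
      exact ((isUnit_single _ hne).mul (isUnit_single _ hne)).ne_zero
    · rw [map_mul, hmul, hmul, mul_mul_mul_comm, single_mul_single, single_mul_single]
      congr 2
      ring
    · rw [map_mul, hmul, pow_one]
      ring
  · rw [hF0eq, mul_assoc]
    exact hasOrd_one_of_isCoprime hK hα (mul_ne_zero (hF0 1) (hF0 1))
      (hΘα.mul_right (hFα 2 (Or.inr rfl)))
      ((hFα 1 (Or.inl rfl)).mul_right (hFα 1 (Or.inl rfl)))
  · refine hasOrd_zero_of_isCoprime hK hβ (mul_ne_zero (hF0 1) (hF0 1))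
      (IsCoprime.mul_right (hFcop hβ 0 fun n h => hconj ?_) (hFβ 2 (Or.inr rfl)))
      ((hFβ 1 (Or.inl rfl)).mul_right (hFβ 1 (Or.inl rfl)))
    -- A common root of `φ_β` and some `φ_α(q ^ n X)` would make `q ^ n β` conjugate to `α`; only
    -- integral powers of `q` arise, whence the root index `0`.
    refine ⟨_, h, 0, -n, ?_⟩
    rw [← mul_assoc, ← map_mul, pow_zero, one_mul, zpow_neg, inv_mul_cancel₀ (hqn n), map_one,
      one_mul]

end PerfMero

theorem mainTheorem7 (p : ℕ) [Fact p.Prime] (K : Type*) [NontriviallyNormedField K]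
    [IsUltrametricDist K] [CompleteSpace K] (hK : IsPerfectoidField p K)
    (q : RootSystem p K) (hq : ‖q.seq 0‖ < 1)
    (α : AlgebraicClosure K) (hα : α ≠ 0) :
    (∃ f : PerfMero p K, PerfMero.IsPeriodic q f ∧ PerfMero.HasOrd f α 1) ∧
    ∀ β : AlgebraicClosure K, β ≠ 0 → ¬ PerfMero.IsConjModQ q α β →
      ∃ f : PerfMero p K, PerfMero.IsPeriodic q f ∧ PerfMero.HasOrd f α 1 ∧
        PerfMero.HasOrd f β 0 := by
  refine ⟨?_, fun β hβ hconj => ?_⟩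
  · obtain ⟨f, hf, hfα, -⟩ := PerfMero.exists_isPeriodic hK q hq hα hα
    exact ⟨f, hf, hfα⟩
  · obtain ⟨f, hf, hfα, hfβ⟩ := PerfMero.exists_isPeriodic hK q hq hα hβ
    exact ⟨f, hf, hfα, hfβ hconj⟩
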